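/- Let $n\ge 1$. A signed permutation is a permutation $\sigma$ of $\{\pm1,\dots,\pm n\}$ with $\sigma(-j)=-\sigma(j)$ for all $j$; for $1\le i\le n$ write $\sigma(i)=\epsilon_i\,|\sigma(i)|$ with $\epsilon_i\in\{\pm1\}$. Spindle-equivalence is the equivalence relation on signed permutations (for fixed $n$) generated by the following moves $\sigma\sim\mu$, in which every segment $i\mapsto|\sigma(i)|$ keeps its sign: 1. (circular move) for some integers $0\le s,t<n$ and all $1\le i\le n$: $|\mu(i)|\equiv s+|\sigma(i')| \pmod n$ and $\operatorname{sign}\mu(i)=\operatorname{sign}\sigma(i')$, where $i'\in\{1,\dots,n\}$, $i'\equiv i+t\pmod n$; 2. (vertical reflection of a block) for some $0\le k\le n$ with $|\sigma(i)|\le k$ for all $1\le i\le k$: $|\mu(i)|=k+1-|\sigma(k+1-i)|$ and $\operatorname{sign}\mu(i)=\operatorname{sign}\sigma(k+1-i)$ for $1\le i\le k$, and $\mu(i)=\sigma(i)$ for $k<i\le n$; 3. (horizontal reflection of a block) for some $0\le k\le n$ with $|\sigma(i)|\le k$ for all $1\le i\le k$: $\mu(i)=\sigma^{-1}(i)$ for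 $1\le i\le k$, and $\mu(i)=\sigma(i)$ for $k<i\le n$. Let $P$ be a regular polygon with $n$ edges $E_1,\dots,E_n$ in clockwise cyclic order (topologically a closed disc whose boundary circle is divided into $n$ arcs, so that $n=1,2$ are allowed). Orient each $E_i$ clockwise, i.e. starting at the vertex shared with $E_{i-1}$ (indices modulo $n$), and let $E_{-i}$ be $E_i$ with the opposite orientation. Let $P'$, with oriented edges $E'_{\pm1},\dots,E'_{\pm n}$, be the image of $P$ under an orientation-reversing isometry. For a signed permutation $\sigma$ let $\Sigma(\sigma)$ be the compact surface obtained from the disjoint union of $P$ and $P'$ by gluing the oriented edge $E_i$ onto the oriented edge $E'_{\sigma(i)}$ for $i=1,\dots,n$. It is a CW complex with two $2$-cells (the interiors of $P$ and $P'$), $n$ $1$-cells, and $v(\sigma)$ $0$-cells (the points of $\Sigma(\sigma)$ that are images of vertices of $P$ or $P'$). If $\sigma$ and $\tau$ are spindle-equivalent signed permutations of $\{\pm1,\dots,\pm n\}$, then $v(\sigma)=v(\tau)$, and the surfaces $\Sigma(\sigma)$ and $\Sigma(\tau)$ are homeomorphic. -/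

import Mathlib

open scoped ComplexConjugate

namespace Spindle

/-- The set `{±1, …, ±n}`: the pair `(i, ε)` stands for the integer `ε * (i + 1)`. -/
abbrev SignedIndex (n : ℕ) : Type := Fin n × ℤˣ

/-- The negation `j ↦ -j` on `{±1, …, ±n}`. -/
def SignedIndex.opp {n : ℕ} (p : SignedIndex n) : SignedIndex n := (p.1, -p.2)

/-- A signed permutation: a permutation `σ` of `{±1, …, ±n}` such that `σ (-j) = -σ j`. -/
structure SignedPerm (n : ℕ) where
  toPerm : Equiv.Perm (SignedIndex n)
  map_opp : ∀ p : SignedIndex n, toPerm p.opp = (toPerm p).opp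

/-- The reversal of the first `k` indices, `i ↦ k + 1 - i` for `1 ≤ i ≤ k` (this is
`i ↦ k - 1 - i` for indices counted from `0`); the other indices are fixed. -/
def revBlock {n : ℕ} (k : Fin (n + 1)) (i : Fin n) : Fin n :=
  if h : i.val < k.val then ⟨k.val - 1 - i.val, by omega⟩ else i

/-- The first `k` indices form a block of `σ`: `|σ i| ≤ k` for `1 ≤ i ≤ k`. -/
def IsInitialBlock {n : ℕ} (σ : SignedPerm n) (k : Fin (n + 1)) : Prop :=
  ∀ i : Fin n, i.val < k.val → (σ.toPerm (i, 1)).1.val < k.val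

/-- The three types of spindle moves on signed permutations. Positions and absolute values are
moved as for ordinary permutations, and each segment `i ↦ |σ i|` keeps its sign. -/
inductive SpindleMove {n : ℕ} : SignedPerm n → SignedPerm n → Prop
  /-- Circular move: `|μ i| = s + |σ (i + t)|` modulo `n` (addition in `Fin n` is modulo `n`). -/
  | circular (σ μ : SignedPerm n) (s t : Fin n)
      (h : ∀ (i : Fin n) (ε : ℤˣ),
        μ.toPerm (i, ε) = (s + (σ.toPerm (i + t, ε)).1, (σ.toPerm (i + t, ε)).2)) :
      SpindleMove σ μ
  /-- Vertical reflection of a block: `|μ i| = k + 1 - |σ (k + 1 - i)|` for `i ≤ k`. -/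
  | vertical (σ μ : SignedPerm n) (k : Fin (n + 1)) (hk : IsInitialBlock σ k)
      (h : ∀ (i : Fin n) (ε : ℤˣ),
        μ.toPerm (i, ε) =
          if i.val < k.val then
            (revBlock k (σ.toPerm (revBlock k i, ε)).1, (σ.toPerm (revBlock k i, ε)).2)
          else σ.toPerm (i, ε)) :
      SpindleMove σ μ
  /-- Horizontal reflection of a block: `μ i = σ⁻¹ i` for `i ≤ k`. -/
  | horizontal (σ μ : SignedPerm n) (k : Fin (n + 1)) (hk : IsInitialBlock σ k)
      (h : ∀ (i : Fin n) (ε : ℤˣ),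
        μ.toPerm (i, ε) =
          if i.val < k.val then σ.toPerm.symm (i, ε) else σ.toPerm (i, ε)) :
      SpindleMove σ μ

/-- Spindle-equivalence: the equivalence relation generated by the spindle moves. -/
def SpindleEquiv {n : ℕ} (σ τ : SignedPerm n) : Prop :=
  Relation.EqvGen SpindleMove σ τ

/-- The polygon as a topological space: the closed unit disc. Its edges are the `n` arcs `edge`
into which the `n`-th roots of unity cut the boundary circle; this makes sense for every
`n ≥ 1`, and for `n ≥ 3` it is the usual straight-edged regular polygon up to a homeomorphism
respecting vertices and edges. -/
abbrev Polygon : Type := Metric.closedBall (0 : ℂ) 1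

/-- The constant-speed parametrization of the edge with number `i` (counted from `0`) of the
polygon `P`; the edges follow each other clockwise and each is traversed clockwise, that is,
starting from the vertex it shares with its predecessor. -/
noncomputable def edge {n : ℕ} (i : Fin n) (s : unitInterval) : Polygon :=
  ⟨(Circle.exp (-(2 * Real.pi * ((i.val : ℝ) + (s : ℝ)) / (n : ℝ))) : ℂ),
    mem_closedBall_zero_iff.2 (Circle.norm_coe _).le⟩

/-- The oriented edges `E_1, …, E_n, E_{-1}, …, E_{-n}`, where `E_{-i}` is the edge `E_i` with
the opposite orientation. -/
noncomputable def orientedEdge {n : ℕ} (p : SignedIndex n) (s : unitInterval) : Polygon :=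
  edge p.1 (if p.2 = 1 then s else unitInterval.symm s)

/-- The reflection `z ↦ conj z`, an orientation-reversing isometry that takes `P` to the second
polygon `P'` and the oriented edge `E_j` to `E'_j`. -/
noncomputable def mirror (z : Polygon) : Polygon :=
  ⟨conj (z : ℂ), by
    rw [mem_closedBall_zero_iff, Complex.norm_conj]; exact mem_closedBall_zero_iff.1 z.2⟩

/-- The gluing of the oriented edge `E_i` of `P` (left summand) onto the oriented edge
`E'_{σ i}` of `P'` (right summand), for `i = 1, …, n`. -/
inductive Glue {n : ℕ} (σ : SignedPerm n) : Polygon ⊕ Polygon → Polygon ⊕ Polygon → Prop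
  | glue (i : Fin n) (s : unitInterval) :
      Glue σ (Sum.inl (orientedEdge (i, 1) s))
        (Sum.inr (mirror (orientedEdge (σ.toPerm (i, 1)) s)))

/-- The surface `Σ(σ)`: the quotient of the disjoint union of `P` and `P'` by the equivalence
relation generated by the gluing, with the quotient topology. -/
def Surface {n : ℕ} (σ : SignedPerm n) : Type := Quot (Glue σ)

instance {n : ℕ} (σ : SignedPerm n) : TopologicalSpace (Surface σ) :=
  inferInstanceAs (TopologicalSpace (Quot (Glue σ)))

/-- The `0`-cells of `Σ(σ)`: the images of the vertices of `P` and of `P'`. Each vertex of `P` is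
the starting point of exactly one edge `E_i`. -/
def zeroCells {n : ℕ} (σ : SignedPerm n) : Set (Surface σ) :=
  Set.range (fun i : Fin n => (Quot.mk (Glue σ) (Sum.inl (edge i 0)) : Surface σ)) ∪
    Set.range (fun i : Fin n => (Quot.mk (Glue σ) (Sum.inr (mirror (edge i 0))) : Surface σ))

/-- The number `v(σ)` of `0`-cells of `Σ(σ)` (a finite set). -/
noncomputable def vertexCount {n : ℕ} (σ : SignedPerm n) : ℕ := (zeroCells σ).ncard

end Spindle

/-! A surface glued from polygons is recorded by boundary words. The edges of `P` carry the letters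
0, …, n-1 in order (`sourceWord`), and edge `j` of `P'` carries the signed letter σ⁻¹(j)
(`targetWord`). Mirroring `P'` makes both words read clockwise around a disc
(`surface_markedHomeo`). Every comparison below is a `MarkedHomeo`, a homeomorphism of quotients
that carries vertices to vertices, so it preserves the topology and the number of 0-cells at once.
It then suffices to treat one spindle move.

A circular move only rotates the two words and renames letters. For a reflection of a block with 0 <
k < n, write the words as A b B and C D. Here A and C are the first k letters, each letter below k
occurs once in A and once in C, and b is the letter k, which occurs once in D as b or b⁻¹. After
renaming, the reflections replace (A, C) by (A⁻¹, C⁻¹) or by (C, A), where the exponent -1 is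
`wordInv`. Gluing the two polygons along b gives one polygon with a word A y C z, or A y C⁻¹ z if
the second polygon must be turned over first, where y and z have no letters below k. So it is enough
to interchange or invert the outer segments (`wordEquiv_of_segments`, applied in `pairEquiv_block`).

For this, y and z are shrunk to single marker letters k and k+1, and only edges with letters below k
are cut and glued. Pairing those edges gives a surface with two marked boundary edges. As in the
classical normal form, crosscaps, handles and spurs split off until a disc or an annulus with two
markers remains (`splits_or_base`). These have evident symmetries interchanging the markers, with or
without reversal, and the symmetry extends over the split-off blocks (`IsBlock.append_congr`,
`IsMarkedWord.wordSim_markerSwap`). The cutting and gluing never touches the markers, so y and z can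
be substituted back (`WordSim.flatMap`). Thus A y C z becomes A z C y or A z⁻¹ C y⁻¹, and a
rotation, or an inversion and a rotation, gives C y A z or A⁻¹ y C⁻¹ z.

The topological input is `exists_merge`, gluing two discs along a boundary arc, from which
`wordEquiv_cross` and `wordEquiv_slide` follow: cut along a new edge, glue along an old one, rename.
-/

namespace Spindle

open Set Topology unitInterval

/-! ### Polar coordinates and radial homeomorphisms of the disc. -/

/-- The point `r * exp (-2πit)` of the disc. -/
noncomputable def polarPoint (r : I) (t : ℝ) : Polygon :=
  ⟨(r : ℝ) * (Circle.exp (-(2 * Real.pi * t)) : ℂ), by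
    rw [mem_closedBall_zero_iff, norm_mul, Circle.norm_coe, mul_one, Complex.norm_real,
      Real.norm_of_nonneg r.2.1]
    exact r.2.2⟩

/-- The point of the boundary circle at clockwise angle `2πt`. -/
noncomputable def boundaryPoint (t : ℝ) : Polygon :=
  ⟨(Circle.exp (-(2 * Real.pi * t)) : ℂ), mem_closedBall_zero_iff.2 (Circle.norm_coe _).le⟩

lemma polarPoint_one (t : ℝ) : polarPoint 1 t = boundaryPoint t := by
  ext1; simp [polarPoint, boundaryPoint]

lemma continuous_polarPoint : Continuous fun p : I × I => polarPoint p.1 (p.2 : ℝ) := by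
  unfold polarPoint
  refine Continuous.subtype_mk ?_ _
  have h : Continuous fun p : I × I => Circle.exp (-(2 * Real.pi * (p.2 : ℝ))) :=
    Circle.exp.continuous.comp (by fun_prop)
  exact (Complex.continuous_ofReal.comp (by fun_prop)).mul (continuous_subtype_val.comp h)

lemma norm_polarPoint (r : I) (t : ℝ) : ‖(polarPoint r t : ℂ)‖ = r := by
  rw [polarPoint, norm_mul, Circle.norm_coe, mul_one, Complex.norm_real,
    Real.norm_of_nonneg r.2.1]

lemma circleExp_eq_iff (t t' : ℝ) :
    Circle.exp (-(2 * Real.pi * t)) = Circle.exp (-(2 * Real.pi * t')) ↔ ∃ m : ℤ, t = t' + m := by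
  rw [Circle.exp_eq_exp]
  have hpi : (2 * Real.pi) ≠ 0 := by positivity
  constructor
  · rintro ⟨m, hm⟩
    refine ⟨-m, mul_left_cancel₀ hpi ?_⟩
    push_cast; linarith
  · rintro ⟨m, rfl⟩
    exact ⟨-m, by push_cast; ring⟩

lemma boundaryPoint_eq_iff (t t' : ℝ) :
    boundaryPoint t = boundaryPoint t' ↔ ∃ m : ℤ, t = t' + m := by
  rw [← circleExp_eq_iff, boundaryPoint, boundaryPoint, Subtype.mk.injEq, Circle.coe_inj]

lemma polarPoint_surjective : Function.Surjective fun p : I × I => polarPoint p.1 (p.2 : ℝ) := by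
  intro z
  have hz : ‖(z : ℂ)‖ ≤ 1 := mem_closedBall_zero_iff.1 z.2
  refine ⟨(⟨‖(z : ℂ)‖, norm_nonneg _, hz⟩,
    ⟨Int.fract (-(Complex.arg z) / (2 * Real.pi)), Int.fract_nonneg _, (Int.fract_lt_one _).le⟩), ?_⟩
  ext1
  have : Circle.exp (-(2 * Real.pi * Int.fract (-(Complex.arg z) / (2 * Real.pi)))) =
      Circle.exp (Complex.arg z) := by
    have h2 : Complex.arg z = -(2 * Real.pi * (-(Complex.arg z) / (2 * Real.pi))) := by
      field_simp
    conv_rhs => rw [h2]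
    rw [circleExp_eq_iff]
    exact ⟨-⌊-(Complex.arg z) / (2 * Real.pi)⌋, by rw [Int.fract]; push_cast; ring⟩
  simp only [polarPoint]
  rw [this, Circle.coe_exp]
  exact Complex.norm_mul_exp_arg_mul_I z

lemma polarPoint_eq {r r' : I} {t t' : I} (h : polarPoint r t = polarPoint r' t') :
    r = r' ∧ (r = 0 ∨ t = t' ∨ (t = 0 ∧ t' = 1) ∨ (t = 1 ∧ t' = 0)) := by
  have hr : r = r' := by
    ext1; rw [← norm_polarPoint r t, ← norm_polarPoint r' t', h]
  subst hr
  refine ⟨rfl, ?_⟩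
  by_cases h0 : r = 0
  · exact Or.inl h0
  right
  have hr0 : ((r : ℝ) : ℂ) ≠ 0 := by
    simpa [Complex.ofReal_eq_zero] using h0
  have h1 := congrArg Subtype.val h
  simp only [polarPoint] at h1
  have h2 := mul_left_cancel₀ hr0 h1
  rw [Circle.coe_inj, circleExp_eq_iff] at h2
  obtain ⟨m, hm⟩ := h2
  have a1 := t.2.1
  have a2 := t.2.2
  have a3 := t'.2.1
  have a4 := t'.2.2
  have m1 : m ≤ 1 := by
    have : (m : ℝ) ≤ 1 := by linarith
    exact_mod_cast this
  have m2 : -1 ≤ m := by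
    have : (-1 : ℝ) ≤ m := by linarith
    exact_mod_cast this
  obtain rfl | rfl | rfl : m = -1 ∨ m = 0 ∨ m = 1 := by omega
  · right; left; push_cast at hm
    exact ⟨Subtype.ext (show (t : ℝ) = 0 by linarith),
      Subtype.ext (show (t' : ℝ) = 1 by linarith)⟩
  · left; ext1; simpa using hm
  · right; right; push_cast at hm
    exact ⟨Subtype.ext (show (t : ℝ) = 1 by linarith),
      Subtype.ext (show (t' : ℝ) = 0 by linarith)⟩

/-- Polar coordinates are a continuous surjection from a compact space to a Hausdorff one, hence a
quotient map. The map (r, t) ↦ (r, φ t) descends because `φ` fixes both ends of the seam t = 0, 1,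
and the angle is irrelevant at r = 0. -/
lemma exists_radial_map {φ : I → I} (hφ : Continuous φ) (h0 : φ 0 = 0) (h1 : φ 1 = 1) :
    ∃ F : Polygon → Polygon, Continuous F ∧
      ∀ r t : I, F (polarPoint r t) = polarPoint r (φ t) := by
  let f : C(I × I, Polygon) := ⟨fun p => polarPoint p.1 (p.2 : ℝ), continuous_polarPoint⟩
  have hq : IsQuotientMap f :=
    continuous_polarPoint.isClosedMap.isQuotientMap continuous_polarPoint polarPoint_surjective
  let g : C(I × I, Polygon) := ⟨fun p => polarPoint p.1 (φ p.2),
    continuous_polarPoint.comp (continuous_fst.prodMk (hφ.comp continuous_snd))⟩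
  have bdry : ∀ r : I, polarPoint r (0 : ℝ) = polarPoint r (1 : ℝ) := by
    intro r; simp [polarPoint]
  have hg : Function.FactorsThrough g f := by
    rintro ⟨r, t⟩ ⟨r', t'⟩ h
    obtain ⟨rfl, h⟩ := polarPoint_eq h
    simp only [g, ContinuousMap.coe_mk]
    rcases h with rfl | rfl | ⟨rfl, rfl⟩ | ⟨rfl, rfl⟩
    · ext1; simp [polarPoint]
    · rfl
    · simpa [h0, h1] using bdry r
    · simpa [h0, h1] using (bdry r).symm
  refine ⟨hq.lift g hg, (hq.lift g hg).continuous, fun r t => ?_⟩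
  exact congrArg (fun k : C(I × I, Polygon) => k (r, t)) (hq.lift_comp g hg)

/-- A homeomorphism of the interval fixing the endpoints extends radially to the disc. -/
lemma exists_radial_homeomorph (φ : I ≃ₜ I) (h0 : φ 0 = 0) (h1 : φ 1 = 1) :
    ∃ F : Polygon ≃ₜ Polygon, ∀ t : I, F (boundaryPoint t) = boundaryPoint (φ t) := by
  obtain ⟨F, hF, hF'⟩ := exists_radial_map φ.continuous h0 h1
  obtain ⟨G, hG, hG'⟩ := exists_radial_map φ.symm.continuous
    ((Homeomorph.symm_apply_eq _).2 h0.symm) ((Homeomorph.symm_apply_eq _).2 h1.symm)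
  refine ⟨⟨⟨F, G, fun z => ?_, fun z => ?_⟩, hF, hG⟩, fun t => ?_⟩
  · obtain ⟨⟨r, t⟩, rfl⟩ := polarPoint_surjective z
    simp [hF', hG']
  · obtain ⟨⟨r, t⟩, rfl⟩ := polarPoint_surjective z
    simp [hF', hG']
  · change F _ = _
    rw [← polarPoint_one, hF', polarPoint_one]

/-- The piecewise linear map of the line that sends `0, b, 1` to `0, 1/2, 1`. -/
noncomputable def bendMap (b t : ℝ) : ℝ :=
  if t ≤ b then t / (2 * b) else 1 - (1 - t) / (2 * (1 - b))

noncomputable def unbendMap (b t : ℝ) : ℝ :=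
  if t ≤ 1 / 2 then 2 * b * t else 1 - 2 * (1 - b) * (1 - t)

/-- The radial extension of a piecewise linear reparametrization. It makes any division of the
circle into two arcs starting at parameter 0 into the division into lower and upper semicircle, with
constant speed on each arc. -/
lemma exists_bend_homeomorph {b : ℝ} (hb0 : 0 < b) (hb1 : b < 1) :
    ∃ F : Polygon ≃ₜ Polygon,
      (∀ t : ℝ, 0 ≤ t → t ≤ 1 → F (boundaryPoint (b * t)) = boundaryPoint (t / 2)) ∧
      (∀ t : ℝ, 0 ≤ t → t ≤ 1 →
        F (boundaryPoint (b + (1 - b) * t)) = boundaryPoint ((1 + t) / 2)) := by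
  have hb2 : 0 < 1 - b := by linarith
  have c1 : Continuous (bendMap b) := by
    unfold bendMap
    refine Continuous.if_le (by fun_prop) (by fun_prop) continuous_id continuous_const ?_
    intro x hx
    subst hx; field_simp; ring
  have c2 : Continuous (unbendMap b) := by
    unfold unbendMap
    refine Continuous.if_le (by fun_prop) (by fun_prop) continuous_id continuous_const ?_
    intro x hx
    subst hx; field_simp; ring
  have m1 : ∀ t : I, bendMap b t ∈ I := by
    intro t
    have := t.2.1
    have := t.2.2
    unfold bendMap
    split_ifs with h
    · refine ⟨by positivity, ?_⟩
      rw [div_le_one (by positivity)]; linarith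
    · push Not at h
      have e1 : (1 - (t : ℝ)) / (2 * (1 - b)) ≤ 1 := by
        rw [div_le_one (by positivity)]; linarith
      have e2 : 0 ≤ (1 - (t : ℝ)) / (2 * (1 - b)) := div_nonneg (by linarith) (by positivity)
      constructor <;> linarith
  have m2 : ∀ t : I, unbendMap b t ∈ I := by
    intro t
    have := t.2.1
    have := t.2.2
    unfold unbendMap
    split_ifs with h
    · refine ⟨by positivity, ?_⟩
      nlinarith
    · push Not at h
      constructor <;> nlinarith
  have l1 : ∀ t : ℝ, unbendMap b (bendMap b t) = t := by
    intro t
    unfold bendMap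
    split_ifs with h
    · have : t / (2 * b) ≤ 1 / 2 := by
        rw [div_le_div_iff₀ (by positivity) (by positivity)]; linarith
      rw [unbendMap, if_pos this]; field_simp
    · push Not at h
      have : ¬ 1 - (1 - t) / (2 * (1 - b)) ≤ 1 / 2 := by
        have : (1 - t) / (2 * (1 - b)) < 1 / 2 := by
          rw [div_lt_div_iff₀ (by positivity) (by positivity)]; linarith
        linarith
      rw [unbendMap, if_neg this]; field_simp; ring
  have l2 : ∀ t : ℝ, bendMap b (unbendMap b t) = t := by
    intro t
    unfold unbendMap
    split_ifs with h
    · have : 2 * b * t ≤ b := by nlinarith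
      rw [bendMap, if_pos this]; field_simp
    · push Not at h
      have : ¬ 1 - 2 * (1 - b) * (1 - t) ≤ b := by nlinarith
      rw [bendMap, if_neg this]; field_simp; ring
  let φ : I ≃ₜ I :=
    { toFun := fun t => ⟨bendMap b t, m1 t⟩
      invFun := fun t => ⟨unbendMap b t, m2 t⟩
      left_inv := fun t => Subtype.ext (l1 t)
      right_inv := fun t => Subtype.ext (l2 t)
      continuous_toFun := (c1.comp continuous_subtype_val).subtype_mk _
      continuous_invFun := (c2.comp continuous_subtype_val).subtype_mk _ }
  obtain ⟨F, hF⟩ := exists_radial_homeomorph φ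
    (by ext1; simp [φ, bendMap, hb0.le]) (by ext1; simp [φ, bendMap, hb1])
  refine ⟨F, fun t h0 h1 => ?_, fun t h0 h1 => ?_⟩
  · have := hF ⟨b * t, by positivity, by nlinarith⟩
    simp only at this
    rw [this]
    congr 1
    have h : unbendMap b (t / 2) = b * t := by
      rw [unbendMap, if_pos (by linarith)]; ring
    simp [φ, ← h, l2]
  · have := hF ⟨b + (1 - b) * t, by positivity, by nlinarith⟩
    simp only at this
    rw [this]
    congr 1
    have h : unbendMap b ((1 + t) / 2) = b + (1 - b) * t := by
      unfold unbendMap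
      split_ifs with h
      · have : t = 0 := by linarith
        subst this; ring
      · ring
    simp [φ, ← h, l2]

/-! ### Halves of the disc and gluing two discs along an arc. -/

/-- Half the height of the disc above the real point `x`. -/
noncomputable def halfHeight (z : Polygon) : ℝ := √(1 - (z : ℂ).re ^ 2)

lemma abs_im_le_halfHeight (z : Polygon) : |(z : ℂ).im| ≤ halfHeight z := by
  have h : ‖(z : ℂ)‖ ≤ 1 := mem_closedBall_zero_iff.1 z.2
  have h2 : ‖(z : ℂ)‖ ^ 2 ≤ 1 := pow_le_one₀ (norm_nonneg _) h
  rw [← Complex.normSq_eq_norm_sq, Complex.normSq_apply] at h2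
  exact Real.abs_le_sqrt (by nlinarith)

lemma mem_disc_of_abs_im_le {x y : ℝ} (z : Polygon) (hx : x = (z : ℂ).re)
    (h : |y| ≤ halfHeight z) : (⟨x, y⟩ : ℂ) ∈ Metric.closedBall (0 : ℂ) 1 := by
  have hz : ‖(z : ℂ)‖ ≤ 1 := mem_closedBall_zero_iff.1 z.2
  have h2 : ‖(z : ℂ)‖ ^ 2 ≤ 1 := pow_le_one₀ (norm_nonneg _) hz
  rw [← Complex.normSq_eq_norm_sq, Complex.normSq_apply] at h2
  have h3 : y ^ 2 ≤ 1 - (z : ℂ).re ^ 2 := by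
    rw [← sq_abs y, ← Real.sq_sqrt (show (0 : ℝ) ≤ 1 - (z : ℂ).re ^ 2 by nlinarith)]
    exact pow_le_pow_left₀ (abs_nonneg _) h 2
  rw [mem_closedBall_zero_iff, ← sq_le_one_iff₀ (norm_nonneg _), ← Complex.normSq_eq_norm_sq,
    Complex.normSq_apply]
  simp only [hx]
  nlinarith

/-- The map of the disc onto its lower half that fixes the lower semicircle. -/
noncomputable def lowerHalf (z : Polygon) : Polygon :=
  ⟨⟨(z : ℂ).re, ((z : ℂ).im - halfHeight z) / 2⟩, mem_disc_of_abs_im_le z rfl (by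
    have := abs_le.1 (abs_im_le_halfHeight z)
    rw [abs_le]; constructor <;> linarith)⟩

/-- The map of the disc onto its upper half that fixes the upper semicircle. -/
noncomputable def upperHalf (z : Polygon) : Polygon :=
  ⟨⟨(z : ℂ).re, ((z : ℂ).im + halfHeight z) / 2⟩, mem_disc_of_abs_im_le z rfl (by
    have := abs_le.1 (abs_im_le_halfHeight z)
    rw [abs_le]; constructor <;> linarith)⟩

lemma continuous_complex_mk {X : Type*} [TopologicalSpace X] {f g : X → ℝ} (hf : Continuous f)
    (hg : Continuous g) : Continuous fun x => (⟨f x, g x⟩ : ℂ) := by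
  have : (fun x => (⟨f x, g x⟩ : ℂ)) = fun x => (f x : ℂ) + g x * Complex.I := by
    funext x; rw [Complex.mk_eq_add_mul_I]
  rw [this]; fun_prop

lemma continuous_re_polygon : Continuous fun z : Polygon => (z : ℂ).re :=
  Complex.continuous_re.comp continuous_subtype_val

lemma continuous_im_polygon : Continuous fun z : Polygon => (z : ℂ).im :=
  Complex.continuous_im.comp continuous_subtype_val

lemma continuous_halfHeight : Continuous halfHeight := by
  unfold halfHeight
  exact Real.continuous_sqrt.comp (continuous_const.sub (continuous_re_polygon.pow 2))

lemma continuous_lowerHalf : Continuous lowerHalf :=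
  (continuous_complex_mk continuous_re_polygon
    ((continuous_im_polygon.sub continuous_halfHeight).div_const 2)).subtype_mk _

lemma continuous_upperHalf : Continuous upperHalf :=
  (continuous_complex_mk continuous_re_polygon
    ((continuous_im_polygon.add continuous_halfHeight).div_const 2)).subtype_mk _

lemma halfHeight_eq_of_re_eq {z z' : Polygon} (h : (z : ℂ).re = (z' : ℂ).re) :
    halfHeight z = halfHeight z' := by rw [halfHeight, halfHeight, h]

lemma lowerHalf_injective : Function.Injective lowerHalf := by
  intro z z' h
  have h1 := congrArg (fun w : Polygon => (w : ℂ).re) h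
  have h2 := congrArg (fun w : Polygon => (w : ℂ).im) h
  simp only [lowerHalf] at h1 h2
  have := halfHeight_eq_of_re_eq h1
  exact Subtype.ext (Complex.ext h1 (by linarith))

lemma upperHalf_injective : Function.Injective upperHalf := by
  intro z z' h
  have h1 := congrArg (fun w : Polygon => (w : ℂ).re) h
  have h2 := congrArg (fun w : Polygon => (w : ℂ).im) h
  simp only [upperHalf] at h1 h2
  have := halfHeight_eq_of_re_eq h1
  exact Subtype.ext (Complex.ext h1 (by linarith))

lemma boundaryPoint_re (t : ℝ) : (boundaryPoint t : ℂ).re = Real.cos (2 * Real.pi * t) := by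
  rw [boundaryPoint, Circle.coe_exp, Complex.exp_ofReal_mul_I_re, Real.cos_neg]

lemma boundaryPoint_im (t : ℝ) : (boundaryPoint t : ℂ).im = -Real.sin (2 * Real.pi * t) := by
  rw [boundaryPoint, Circle.coe_exp, Complex.exp_ofReal_mul_I_im, Real.sin_neg]

lemma halfHeight_boundaryPoint (t : ℝ) :
    halfHeight (boundaryPoint t) = |Real.sin (2 * Real.pi * t)| := by
  rw [halfHeight, boundaryPoint_re, Real.abs_sin_eq_sqrt_one_sub_cos_sq]

lemma sin_nonneg_of_le_half {t : ℝ} (h0 : 0 ≤ t) (h1 : t ≤ 1 / 2) :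
    0 ≤ Real.sin (2 * Real.pi * t) :=
  Real.sin_nonneg_of_nonneg_of_le_pi (by positivity) (by nlinarith [Real.pi_pos])

lemma sin_one_sub (t : ℝ) : Real.sin (2 * Real.pi * (1 - t)) = -Real.sin (2 * Real.pi * t) := by
  rw [mul_sub, mul_one, Real.sin_two_pi_sub]

lemma cos_one_sub (t : ℝ) : Real.cos (2 * Real.pi * (1 - t)) = Real.cos (2 * Real.pi * t) := by
  rw [mul_sub, mul_one, Real.cos_two_pi_sub]

lemma lowerHalf_boundaryPoint {t : ℝ} (h0 : 0 ≤ t) (h1 : t ≤ 1 / 2) :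
    lowerHalf (boundaryPoint t) = boundaryPoint t := by
  ext1
  refine Complex.ext rfl ?_
  simp only [lowerHalf]
  rw [halfHeight_boundaryPoint, boundaryPoint_im, abs_of_nonneg (sin_nonneg_of_le_half h0 h1)]
  ring

lemma upperHalf_boundaryPoint {t : ℝ} (h0 : 1 / 2 ≤ t) (h1 : t ≤ 1) :
    upperHalf (boundaryPoint t) = boundaryPoint t := by
  ext1
  refine Complex.ext rfl ?_
  simp only [upperHalf]
  have := sin_nonneg_of_le_half (t := 1 - t) (by linarith) (by linarith)
  rw [sin_one_sub] at this
  rw [halfHeight_boundaryPoint, boundaryPoint_im, abs_of_nonpos (by linarith)]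
  ring

lemma lowerHalf_boundaryPoint_one_sub {t : ℝ} (h0 : 0 ≤ t) (h1 : t ≤ 1 / 2) :
    lowerHalf (boundaryPoint (1 - t)) = upperHalf (boundaryPoint t) := by
  have := sin_nonneg_of_le_half h0 h1
  ext1
  refine Complex.ext ?_ ?_
  · simp only [upperHalf, lowerHalf, boundaryPoint_re, cos_one_sub]
  · simp only [upperHalf, lowerHalf, boundaryPoint_im, halfHeight_boundaryPoint, sin_one_sub,
      abs_neg, abs_of_nonneg this]
    ring

/-- The two half discs meet only in the real diameter, to which `lowerHalf` sends exactly the upper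
semicircle and `upperHalf` exactly the lower one. The parameter t is recovered from the common real
part by `arccos`. -/
lemma exists_of_lowerHalf_eq_upperHalf {z z' : Polygon} (h : lowerHalf z = upperHalf z') :
    ∃ t : ℝ, 0 ≤ t ∧ t ≤ 1 / 2 ∧ z = boundaryPoint (1 - t) ∧ z' = boundaryPoint t := by
  have h1 := congrArg (fun w : Polygon => (w : ℂ).re) h
  have h2 := congrArg (fun w : Polygon => (w : ℂ).im) h
  simp only [lowerHalf, upperHalf] at h1 h2
  have h3 := halfHeight_eq_of_re_eq h1
  have b1 := abs_le.1 (abs_im_le_halfHeight z)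
  have b2 := abs_le.1 (abs_im_le_halfHeight z')
  have e1 : (z : ℂ).im = halfHeight z := by linarith
  have e2 : (z' : ℂ).im = -halfHeight z := by linarith
  have hz : |(z : ℂ).re| ≤ 1 :=
    (Complex.abs_re_le_norm _).trans (mem_closedBall_zero_iff.1 z.2)
  obtain ⟨hz1, hz2⟩ := abs_le.1 hz
  have hpi := Real.pi_pos
  have ht : 2 * Real.pi * (Real.arccos (z : ℂ).re / (2 * Real.pi)) = Real.arccos (z : ℂ).re := by
    field_simp
  refine ⟨Real.arccos (z : ℂ).re / (2 * Real.pi),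
    div_nonneg (Real.arccos_nonneg _) (by positivity), ?_, ?_, ?_⟩
  · rw [div_le_div_iff₀ (by positivity) (by positivity)]
    linarith [Real.arccos_le_pi (z : ℂ).re]
  · ext1
    refine Complex.ext ?_ ?_
    · rw [boundaryPoint_re, cos_one_sub, ht, Real.cos_arccos hz1 hz2]
    · rw [boundaryPoint_im, sin_one_sub, ht, Real.sin_arccos, neg_neg, e1, halfHeight]
  · ext1
    refine Complex.ext ?_ ?_
    · rw [boundaryPoint_re, ht, Real.cos_arccos hz1 hz2, h1]
    · rw [boundaryPoint_im, ht, Real.sin_arccos, e2, halfHeight]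

lemma exists_lowerHalf_or_upperHalf_eq (z : Polygon) :
    (∃ w, lowerHalf w = z) ∨ ∃ w, upperHalf w = z := by
  have b := abs_le.1 (abs_im_le_halfHeight z)
  rcases le_total (z : ℂ).im 0 with h | h
  · left
    refine ⟨⟨⟨(z : ℂ).re, 2 * (z : ℂ).im + halfHeight z⟩, mem_disc_of_abs_im_le z rfl ?_⟩, ?_⟩
    · rw [abs_le]; constructor <;> linarith
    · ext1
      refine Complex.ext rfl ?_
      simp only [lowerHalf, halfHeight]; ring
  · right
    refine ⟨⟨⟨(z : ℂ).re, 2 * (z : ℂ).im - halfHeight z⟩, mem_disc_of_abs_im_le z rfl ?_⟩, ?_⟩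
    · rw [abs_le]; constructor <;> linarith
    · ext1
      refine Complex.ext rfl ?_
      simp only [upperHalf, halfHeight]; ring

/-- Two polygons with `p + 1` and `q + 1` edges are glued along one edge to a polygon with
`p + q` edges. -/
lemma exists_merge {p q : ℕ} (hp : 1 ≤ p) (hq : 1 ≤ q) :
    ∃ F : Polygon ⊕ Polygon → Polygon, Continuous F ∧ Function.Surjective F ∧
      (∀ t : ℝ, 0 ≤ t → t ≤ p →
        F (Sum.inl (boundaryPoint (t / (p + 1)))) = boundaryPoint (t / (p + q))) ∧
      (∀ t : ℝ, 0 ≤ t → t ≤ q →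
        F (Sum.inr (boundaryPoint ((t + 1) / (q + 1)))) = boundaryPoint ((p + t) / (p + q))) ∧
      (∀ t : ℝ, 0 ≤ t → t ≤ 1 → F (Sum.inl (boundaryPoint ((p + t) / (p + 1)))) =
        F (Sum.inr (boundaryPoint ((1 - t) / (q + 1))))) ∧
      (∀ z z', F (Sum.inl z) = F (Sum.inl z') → z = z') ∧
      (∀ z z', F (Sum.inr z) = F (Sum.inr z') → z = z') ∧
      (∀ z z', F (Sum.inl z) = F (Sum.inr z') → ∃ t : ℝ, 0 ≤ t ∧ t ≤ 1 ∧
        z = boundaryPoint ((p + t) / (p + 1)) ∧ z' = boundaryPoint ((1 - t) / (q + 1))) := by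
  have hp' : (1 : ℝ) ≤ p := by exact_mod_cast hp
  have hq' : (1 : ℝ) ≤ q := by exact_mod_cast hq
  -- `A` bends the first p edges of the first polygon to the lower semicircle and its last edge to
  -- the upper one. `B` bends edge 0 of the second polygon to the lower semicircle and the other q
  -- edges to the upper one. Squeezing into half discs then flattens just the two edges to be glued,
  -- with opposite directions, onto the diameter, and `G.symm` gives the p + q outer edges equal
  -- lengths.
  obtain ⟨G, G1, G2⟩ := exists_bend_homeomorph (b := (p : ℝ) / (p + q)) (by positivity)
    (by rw [div_lt_one (by positivity)]; linarith)
  obtain ⟨A, A1, A2⟩ := exists_bend_homeomorph (b := (p : ℝ) / (p + 1)) (by positivity)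
    (by rw [div_lt_one (by positivity)]; linarith)
  obtain ⟨B, B1, B2⟩ := exists_bend_homeomorph (b := (1 : ℝ) / (q + 1)) (by positivity)
    (by rw [div_lt_one (by positivity)]; linarith)
  have A1' : ∀ t : ℝ, 0 ≤ t → t ≤ p → A (boundaryPoint (t / (p + 1))) =
      boundaryPoint (t / p / 2) := by
    intro t h0 h1
    rw [← A1 (t / p) (by positivity) (by rw [div_le_one (by positivity)]; exact h1)]
    congr 2; field_simp
  have A2' : ∀ t : ℝ, 0 ≤ t → t ≤ 1 → A (boundaryPoint ((p + t) / (p + 1))) =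
      boundaryPoint ((1 + t) / 2) := by
    intro t h0 h1
    rw [← A2 t h0 h1]
    congr 2; field_simp; ring
  have B1' : ∀ t : ℝ, 0 ≤ t → t ≤ 1 → B (boundaryPoint (t / (q + 1))) =
      boundaryPoint (t / 2) := by
    intro t h0 h1
    rw [← B1 t h0 h1]
    congr 2; field_simp
  have B2' : ∀ t : ℝ, 0 ≤ t → t ≤ q → B (boundaryPoint ((t + 1) / (q + 1))) =
      boundaryPoint ((1 + t / q) / 2) := by
    intro t h0 h1
    rw [← B2 (t / q) (by positivity) (by rw [div_le_one (by positivity)]; exact h1)]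
    congr 2; field_simp; ring
  have G1' : ∀ t : ℝ, 0 ≤ t → t ≤ p → G.symm (boundaryPoint (t / p / 2)) =
      boundaryPoint (t / (p + q)) := by
    intro t h0 h1
    rw [Homeomorph.symm_apply_eq,
      ← G1 (t / p) (by positivity) (by rw [div_le_one (by positivity)]; exact h1)]
    congr 2; field_simp
  have G2' : ∀ t : ℝ, 0 ≤ t → t ≤ q → G.symm (boundaryPoint ((1 + t / q) / 2)) =
      boundaryPoint ((p + t) / (p + q)) := by
    intro t h0 h1
    rw [Homeomorph.symm_apply_eq,
      ← G2 (t / q) (by positivity) (by rw [div_le_one (by positivity)]; exact h1)]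
    congr 2; field_simp; ring
  refine ⟨Sum.elim (fun z => G.symm (lowerHalf (A z))) (fun z => G.symm (upperHalf (B z))),
    ?_, ?_, ?_, ?_, ?_, ?_, ?_, ?_⟩
  · exact (G.symm.continuous.comp (continuous_lowerHalf.comp A.continuous)).sumElim
      (G.symm.continuous.comp (continuous_upperHalf.comp B.continuous))
  · intro z
    rcases exists_lowerHalf_or_upperHalf_eq (G z) with ⟨w, hw⟩ | ⟨w, hw⟩
    · exact ⟨Sum.inl (A.symm w), by simp [hw]⟩
    · exact ⟨Sum.inr (B.symm w), by simp [hw]⟩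
  · intro t h0 h1
    have : t / p ≤ 1 := by rw [div_le_one (by positivity)]; exact h1
    simp only [Sum.elim_inl]
    rw [A1' t h0 h1, lowerHalf_boundaryPoint (by positivity) (by linarith), G1' t h0 h1]
  · intro t h0 h1
    have : t / q ≤ 1 := by rw [div_le_one (by positivity)]; exact h1
    have : 0 ≤ t / q := by positivity
    simp only [Sum.elim_inr]
    rw [B2' t h0 h1, upperHalf_boundaryPoint (by linarith) (by linarith), G2' t h0 h1]
  · intro t h0 h1
    simp only [Sum.elim_inr, Sum.elim_inl]
    rw [A2' t h0 h1, B1' (1 - t) (by linarith) (by linarith),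
      ← lowerHalf_boundaryPoint_one_sub (by linarith) (by linarith)]
    congr 3; ring
  · intro z z' h
    exact A.injective (lowerHalf_injective (G.symm.injective h))
  · intro z z' h
    exact B.injective (upperHalf_injective (G.symm.injective h))
  · intro z z' h
    obtain ⟨t, h0, h1, e1, e2⟩ := exists_of_lowerHalf_eq_upperHalf (G.symm.injective h)
    -- The parameter s on the glued edge lies at (1 + s) / 2 after `A`; solving (1 + s) / 2 = 1 - t
    -- gives s = 1 - 2t.
    refine ⟨1 - 2 * t, by linarith, by linarith, A.injective ?_, B.injective ?_⟩
    · rw [A2' _ (by linarith) (by linarith), e1]; congr 1; ring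
    · rw [B1' _ (by linarith) (by linarith), e2]; congr 1; ring

end Spindle

namespace Spindle

open Set Topology unitInterval

/-! ### Homeomorphisms of quotients with marked points. -/

section MarkedHomeo

variable {X Y Z : Type*} [TopologicalSpace X] [TopologicalSpace Y] [TopologicalSpace Z]

/-- The quotients by two relations are homeomorphic, compatibly with the images of given sets. -/
def MarkedHomeo (r : X → X → Prop) (V : Set X) (s : Y → Y → Prop) (W : Set Y) : Prop :=
  ∃ h : Quot r ≃ₜ Quot s, h '' (Quot.mk r '' V) = Quot.mk s '' W

variable {r : X → X → Prop} {V : Set X} {s : Y → Y → Prop} {W : Set Y}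
  {t : Z → Z → Prop} {U : Set Z}

lemma MarkedHomeo.refl (r : X → X → Prop) (V : Set X) : MarkedHomeo r V r V :=
  ⟨Homeomorph.refl _, by simp⟩

lemma MarkedHomeo.symm (h : MarkedHomeo r V s W) : MarkedHomeo s W r V := by
  obtain ⟨h, hV⟩ := h
  exact ⟨h.symm, by rw [← hV, Set.image_image]; simp⟩

lemma MarkedHomeo.trans (h : MarkedHomeo r V s W) (h' : MarkedHomeo s W t U) :
    MarkedHomeo r V t U := by
  obtain ⟨h, hV⟩ := h
  obtain ⟨h', hV'⟩ := h'
  refine ⟨h.trans h', ?_⟩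
  rw [← hV', ← hV]
  simp only [Set.image_image]
  rfl

/-- A quotient map that matches the identifications made by two relations induces a homeomorphism
of the quotients. -/
lemma MarkedHomeo.of_isQuotientMap {f : X → Y} (hf : IsQuotientMap f)
    (h₁ : ∀ x x', r x x' → Quot.mk s (f x) = Quot.mk s (f x'))
    (h₂ : ∀ x x', f x = f x' → Quot.mk r x = Quot.mk r x')
    (h₃ : ∀ x x', s (f x) (f x') → Quot.mk r x = Quot.mk r x')
    (hV : f '' V = W) : MarkedHomeo r V s W := by
  let F : C(X, Y) := ⟨f, hf.continuous⟩
  let m : C(X, Quot r) := ⟨Quot.mk r, continuous_quot_mk⟩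
  have hF : IsQuotientMap F := hf
  have hm : Function.FactorsThrough m F := fun x x' h => h₂ x x' h
  -- The inverse homeomorphism: the projection `Quot.mk r` descends along `f` because the fibres of
  -- `f` are already identified by `r`.
  let j := hF.lift m hm
  have hj : ∀ x, j (f x) = Quot.mk r x := fun x =>
    congrArg (fun k : C(X, Quot r) => k x) (hF.lift_comp m hm)
  have hjs : ∀ y y', s y y' → j y = j y' := by
    intro y y' h
    obtain ⟨x, rfl⟩ := hf.surjective y
    obtain ⟨x', rfl⟩ := hf.surjective y'
    rw [hj, hj]
    exact h₃ x x' h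
  refine ⟨⟨⟨Quot.lift (fun x => Quot.mk s (f x)) h₁, Quot.lift j hjs, ?_, ?_⟩, ?_, ?_⟩, ?_⟩
  · rintro ⟨x⟩
    exact hj x
  · rintro ⟨y⟩
    obtain ⟨x, rfl⟩ := hf.surjective y
    change Quot.lift _ h₁ (j (f x)) = _
    rw [hj]
  · exact continuous_quot_lift _ (continuous_quot_mk.comp hf.continuous)
  · exact continuous_quot_lift _ j.continuous
  · rw [← hV, Set.image_image, Set.image_image]
    rfl

lemma MarkedHomeo.of_homeomorph (h : X ≃ₜ Y) (hr : ∀ x x', r x x' ↔ s (h x) (h x'))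
    (hV : h '' V = W) : MarkedHomeo r V s W :=
  .of_isQuotientMap h.isQuotientMap (fun x x' hx => Quot.sound ((hr x x').1 hx))
    (fun _ _ hx => congrArg _ (h.injective hx))
    (fun x x' hx => Quot.sound ((hr x x').2 hx)) hV

end MarkedHomeo

/-! ### Boundary words and labelled polygons. -/

/-- Oriented letters: `(a, 1)` is a letter and `(a, -1)` its inverse. -/
abbrev Letter : Type := ℕ × ℤˣ

def Letter.inv (x : Letter) : Letter := (x.1, -x.2)

@[simp] lemma Letter.inv_inv (x : Letter) : x.inv.inv = x := by simp [Letter.inv]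

@[simp] lemma Letter.inv_fst (x : Letter) : x.inv.1 = x.1 := rfl

@[simp] lemma Letter.inv_snd (x : Letter) : x.inv.2 = -x.2 := rfl

/-- The inverse of a word, read along the boundary of a polygon in the opposite direction. -/
def wordInv (w : List Letter) : List Letter := (w.map Letter.inv).reverse

@[simp] lemma wordInv_nil : wordInv [] = [] := rfl

@[simp] lemma wordInv_append (u v : List Letter) : wordInv (u ++ v) = wordInv v ++ wordInv u := by
  simp [wordInv]

@[simp] lemma wordInv_cons (x : Letter) (v : List Letter) :
    wordInv (x :: v) = wordInv v ++ [x.inv] := by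
  simp [wordInv]

@[simp] lemma wordInv_wordInv (w : List Letter) : wordInv (wordInv w) = w := by
  induction w with
  | nil => rfl
  | cons x w ih => simp [ih]

@[simp] lemma length_wordInv (w : List Letter) : (wordInv w).length = w.length := by
  simp [wordInv]

lemma mem_wordInv {x : Letter} {w : List Letter} : x ∈ wordInv w ↔ x.inv ∈ w := by
  simp only [wordInv, List.mem_reverse, List.mem_map]
  constructor
  · rintro ⟨y, hy, rfl⟩
    simpa using hy
  · intro h
    exact ⟨x.inv, h, by simp⟩

/-- The word does not use the letter `a`. -/
def Avoids (a : ℕ) (w : List Letter) : Prop := ∀ x ∈ w, x.1 ≠ a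

@[simp] lemma avoids_nil (a : ℕ) : Avoids a [] := by simp [Avoids]

@[simp] lemma avoids_append {a : ℕ} {u v : List Letter} :
    Avoids a (u ++ v) ↔ Avoids a u ∧ Avoids a v := by
  simp only [Avoids, List.mem_append]
  constructor
  · intro h; exact ⟨fun x hx => h x (Or.inl hx), fun x hx => h x (Or.inr hx)⟩
  · rintro ⟨h1, h2⟩ x (hx | hx)
    exacts [h1 x hx, h2 x hx]

@[simp] lemma avoids_cons {a : ℕ} {x : Letter} {v : List Letter} :
    Avoids a (x :: v) ↔ x.1 ≠ a ∧ Avoids a v := by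
  simp [Avoids]

@[simp] lemma avoids_wordInv {a : ℕ} {w : List Letter} : Avoids a (wordInv w) ↔ Avoids a w := by
  induction w with
  | nil => simp
  | cons x w ih => simp [ih, and_comm]

/-- The parameter on an edge of the point with parameter `s` on the edge oriented by `ε`. -/
noncomputable def signParam (ε : ℤˣ) (s : I) : I := if ε = 1 then s else σ s

@[simp] lemma signParam_one (s : I) : signParam 1 s = s := by simp [signParam]

@[simp] lemma signParam_neg_one (s : I) : signParam (-1) s = σ s := by
  simp [signParam, show (-1 : ℤˣ) ≠ 1 by decide]

lemma signParam_neg (ε : ℤˣ) (s : I) : signParam (-ε) s = σ (signParam ε s) := by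
  rcases Int.units_eq_one_or ε with rfl | rfl <;> simp

/-- The point of parameter `s` on edge number `i`, oriented by `ε`, of the polygon with `n`
edges. -/
noncomputable def edgePoint (n i : ℕ) (ε : ℤˣ) (s : I) : Polygon :=
  boundaryPoint ((i + (signParam ε s : ℝ)) / n)

/-- The polygon with boundary word `w` carries the label `(x, s)` at the point `z`: there is an
edge through `z` with letter `x^{±1}`, and `z` has parameter `s` in the direction of `x`. -/
def HasLabel (w : List Letter) (z : Polygon) (x : Letter) (s : I) : Prop :=
  ∃ (i : ℕ) (ε : ℤˣ), w[i]? = some (x.1, ε * x.2) ∧ z = edgePoint w.length i ε s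

def HasLabel₂ (w₁ w₂ : List Letter) : Polygon ⊕ Polygon → Letter → I → Prop :=
  Sum.elim (HasLabel w₁) (HasLabel w₂)

/-- Gluing by labels makes sense for arbitrary words: a letter that occurs once gives a free
boundary edge. No condition that letters are paired is needed until the combinatorial part. -/
def LabelRel {Z : Type*} (L : Z → Letter → I → Prop) (z z' : Z) : Prop :=
  ∃ x s, L z x s ∧ L z' x s

/-- The vertices of the polygon with `n` edges. -/
def corners (n : ℕ) : Set Polygon := {z | ∃ i : ℕ, i < n ∧ z = boundaryPoint (i / n)}

def corners₂ (m n : ℕ) : Set (Polygon ⊕ Polygon) :=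
  Sum.inl '' corners m ∪ Sum.inr '' corners n

/-- The surfaces obtained from polygons with boundary words `w` and `w'` are homeomorphic as
surfaces with marked vertices. -/
def WordEquiv (w w' : List Letter) : Prop :=
  MarkedHomeo (LabelRel (HasLabel w)) (corners w.length)
    (LabelRel (HasLabel w')) (corners w'.length)

/-- The surfaces obtained from two pairs of polygons with given boundary words are homeomorphic as
surfaces with marked vertices. -/
def PairEquiv (u v u' v' : List Letter) : Prop :=
  MarkedHomeo (LabelRel (HasLabel₂ u v)) (corners₂ u.length v.length)
    (LabelRel (HasLabel₂ u' v')) (corners₂ u'.length v'.length)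

/-- A homeomorphism of discs that respects the labels given by boundary words. -/
def PolygonIso (w w' : List Letter) : Prop :=
  ∃ h : Polygon ≃ₜ Polygon, (∀ z x s, HasLabel w z x s ↔ HasLabel w' (h z) x s) ∧
    h '' corners w.length = corners w'.length

lemma PolygonIso.refl (w : List Letter) : PolygonIso w w :=
  ⟨Homeomorph.refl _, fun _ _ _ => Iff.rfl, by simp⟩

lemma PolygonIso.trans {u v w : List Letter} (h : PolygonIso u v) (h' : PolygonIso v w) :
    PolygonIso u w := by
  obtain ⟨h, a, b⟩ := h
  obtain ⟨h', a', b'⟩ := h'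
  refine ⟨h.trans h', fun z x s => (a z x s).trans (a' _ x s), ?_⟩
  rw [← b', ← b, Set.image_image]
  rfl

lemma PolygonIso.wordEquiv {w w' : List Letter} (h : PolygonIso w w') : WordEquiv w w' := by
  obtain ⟨h, a, b⟩ := h
  refine .of_homeomorph h (fun z z' => ?_) b
  simp only [LabelRel, a]

lemma PolygonIso.pairEquiv {u v u' v' : List Letter} (h₁ : PolygonIso u u')
    (h₂ : PolygonIso v v') : PairEquiv u v u' v' := by
  obtain ⟨h, a, b⟩ := h₁
  obtain ⟨h', a', b'⟩ := h₂
  refine .of_homeomorph (h.sumCongr h') (fun z z' => ?_) ?_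
  · have key : ∀ z x s, HasLabel₂ u v z x s ↔ HasLabel₂ u' v' (h.sumCongr h' z) x s := by
      rintro (z | z) x s
      · exact a z x s
      · exact a' z x s
    simp only [LabelRel, key]
  · rw [corners₂, corners₂, Set.image_union, Set.image_image, Set.image_image, ← b, ← b',
      Set.image_image, Set.image_image]
    rfl

/-! ### Rotating, reflecting and relabelling polygons. -/

lemma boundaryPoint_add_int (t : ℝ) (m : ℤ) : boundaryPoint (t + m) = boundaryPoint t :=
  (boundaryPoint_eq_iff _ _).2 ⟨m, rfl⟩

lemma boundaryPoint_add_one (t : ℝ) : boundaryPoint (t + 1) = boundaryPoint t := by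
  simpa using boundaryPoint_add_int t 1

lemma boundaryPoint_mem_corners {n : ℕ} (hn : 0 < n) (k : ℕ) :
    boundaryPoint (k / n) ∈ corners n := by
  refine ⟨k % n, Nat.mod_lt _ hn, ?_⟩
  refine (boundaryPoint_eq_iff _ _).2 ⟨(k / n : ℕ), ?_⟩
  have hn' : (n : ℝ) ≠ 0 := by positivity
  have := Nat.mod_add_div k n
  field_simp
  rw [Int.cast_natCast]
  exact_mod_cast this.symm

/-- The rotation of the disc by the angle `2πa`, clockwise. -/
noncomputable def turnMap (a : ℝ) (z : Polygon) : Polygon :=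
  ⟨(Circle.exp (-(2 * Real.pi * a)) : ℂ) * z, by
    rw [mem_closedBall_zero_iff, norm_mul, Circle.norm_coe, one_mul]
    exact mem_closedBall_zero_iff.1 z.2⟩

lemma turnMap_turnMap (a b : ℝ) (z : Polygon) : turnMap a (turnMap b z) = turnMap (a + b) z := by
  ext1
  simp only [turnMap]
  rw [← mul_assoc, ← Circle.coe_mul, ← Circle.exp_add]
  congr 3; ring

lemma turnMap_zero (z : Polygon) : turnMap 0 z = z := by
  ext1; simp [turnMap]

lemma turnMap_one (z : Polygon) : turnMap 1 z = z := by
  ext1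
  have : Circle.exp (-(2 * Real.pi * 1)) = Circle.exp (-(2 * Real.pi * 0)) :=
    (circleExp_eq_iff _ _).2 ⟨1, by simp⟩
  simp only [turnMap, this]
  simp

lemma turnMap_boundaryPoint (a t : ℝ) : turnMap a (boundaryPoint t) = boundaryPoint (a + t) := by
  ext1
  simp only [turnMap, boundaryPoint]
  rw [← Circle.coe_mul, ← Circle.exp_add]
  congr 2; ring

lemma continuous_turnMap (a : ℝ) : Continuous (turnMap a) :=
  (continuous_const.mul continuous_subtype_val).subtype_mk _

noncomputable def turn (a : ℝ) : Polygon ≃ₜ Polygon where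
  toFun := turnMap a
  invFun := turnMap (-a)
  left_inv z := by rw [turnMap_turnMap, neg_add_cancel, turnMap_zero]
  right_inv z := by rw [turnMap_turnMap, add_neg_cancel, turnMap_zero]
  continuous_toFun := continuous_turnMap a
  continuous_invFun := continuous_turnMap _

lemma HasLabel.rotate {u v : List Letter} {z : Polygon} {x : Letter} {s : I}
    (h : HasLabel (u ++ v) z x s) :
    HasLabel (v ++ u) (turnMap (v.length / (u.length + v.length)) z) x s := by
  obtain ⟨i, ε, hi, rfl⟩ := h
  have hi' := (List.getElem?_eq_some_iff.1 hi).1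
  rw [List.length_append] at hi'
  have hn : (u.length + v.length : ℝ) ≠ 0 := by
    have : 0 < u.length + v.length := by omega
    exact_mod_cast this.ne'
  by_cases hiu : i < u.length
  · refine ⟨v.length + i, ε, ?_, ?_⟩
    · rw [List.getElem?_append_left hiu] at hi
      rw [List.getElem?_append_right (by omega), ← hi]
      congr 1; omega
    · rw [edgePoint, edgePoint, turnMap_boundaryPoint]
      congr 1
      simp only [List.length_append]
      push_cast
      rw [add_comm (v.length : ℝ) (u.length : ℝ)]
      field_simp; ring
  · push Not at hiu
    refine ⟨i - u.length, ε, ?_, ?_⟩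
    · rw [List.getElem?_append_right hiu] at hi
      rw [List.getElem?_append_left (by omega), hi]
    · rw [edgePoint, edgePoint, turnMap_boundaryPoint, boundaryPoint_eq_iff]
      refine ⟨1, ?_⟩
      simp only [List.length_append]
      push_cast [Nat.cast_sub hiu]
      rw [add_comm (v.length : ℝ) (u.length : ℝ)]
      field_simp; ring

lemma turnMap_turnMap_complement (m n : ℕ) (z : Polygon) :
    turnMap (m / (n + m)) (turnMap (n / (m + n)) z) = z := by
  rw [turnMap_turnMap]
  rcases Nat.eq_zero_or_pos (m + n) with h | h
  · obtain ⟨rfl, rfl⟩ : m = 0 ∧ n = 0 := by omega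
    simp [turnMap_zero]
  · have : (m + n : ℝ) ≠ 0 := by exact_mod_cast h.ne'
    have h2 : (m / (n + m) + n / (m + n) : ℝ) = 1 := by
      rw [add_comm (n : ℝ) m]; field_simp
    rw [h2, turnMap_one]

lemma turnMap_mem_corners {m n : ℕ} {z : Polygon} (hz : z ∈ corners n) :
    turnMap (m / n) z ∈ corners n := by
  obtain ⟨i, hi, rfl⟩ := hz
  rw [turnMap_boundaryPoint, ← add_div]
  exact_mod_cast boundaryPoint_mem_corners (by omega) (m + i)

lemma polygonIso_rotate (u v : List Letter) : PolygonIso (u ++ v) (v ++ u) := by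
  refine ⟨turn (v.length / (u.length + v.length)), fun z x s => ⟨HasLabel.rotate, fun h => ?_⟩, ?_⟩
  · have := HasLabel.rotate h
    change HasLabel _ (turnMap _ (turnMap _ z)) _ _ at this
    rwa [turnMap_turnMap_complement] at this
  · rw [List.length_append, List.length_append, add_comm v.length]
    apply Set.Subset.antisymm
    · rintro _ ⟨z, hz, rfl⟩
      change turnMap _ z ∈ _
      exact_mod_cast turnMap_mem_corners hz
    · intro z hz
      refine ⟨turnMap (u.length / (v.length + u.length)) z, ?_, ?_⟩
      · have := turnMap_mem_corners (m := u.length) hz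
        rw [add_comm] at this
        rw [add_comm]
        exact_mod_cast this
      · exact turnMap_turnMap_complement _ _ z

lemma mirror_mirror (z : Polygon) : mirror (mirror z) = z := by
  ext1; simp [mirror]

lemma continuous_mirror : Continuous mirror :=
  (Complex.continuous_conj.comp continuous_subtype_val).subtype_mk _

noncomputable def mirrorHomeo : Polygon ≃ₜ Polygon where
  toFun := mirror
  invFun := mirror
  left_inv := mirror_mirror
  right_inv := mirror_mirror
  continuous_toFun := continuous_mirror
  continuous_invFun := continuous_mirror

lemma mirror_boundaryPoint (t : ℝ) : mirror (boundaryPoint t) = boundaryPoint (1 - t) := by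
  ext1
  refine Complex.ext ?_ ?_
  · rw [boundaryPoint_re, cos_one_sub, mirror, Complex.conj_re, boundaryPoint_re]
  · rw [boundaryPoint_im, sin_one_sub, mirror, Complex.conj_im, boundaryPoint_im]

lemma HasLabel.mirror {w : List Letter} {z : Polygon} {x : Letter} {s : I}
    (h : HasLabel w z x s) : HasLabel (wordInv w) (mirror z) x s := by
  obtain ⟨i, ε, hi, rfl⟩ := h
  have hi' := (List.getElem?_eq_some_iff.1 hi).1
  refine ⟨w.length - 1 - i, -ε, ?_, ?_⟩
  · rw [wordInv, List.getElem?_reverse (by simp; omega), List.length_map]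
    have : w.length - 1 - (w.length - 1 - i) = i := by omega
    rw [this, List.getElem?_map, hi]
    simp [Letter.inv]
  · rw [edgePoint, edgePoint, mirror_boundaryPoint, length_wordInv, signParam_neg]
    congr 1
    have hn : (w.length : ℝ) ≠ 0 := by
      have : 0 < w.length := by omega
      exact_mod_cast this.ne'
    rw [Nat.sub_sub, Nat.cast_sub (by omega), unitInterval.coe_symm_eq]
    push_cast
    field_simp; ring

lemma mirror_mem_corners {n : ℕ} {z : Polygon} (hz : z ∈ corners n) : mirror z ∈ corners n := by
  obtain ⟨i, hi, rfl⟩ := hz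
  rw [mirror_boundaryPoint]
  have : (1 - i / n : ℝ) = ((n - i : ℕ) : ℝ) / n := by
    have hn : (n : ℝ) ≠ 0 := by
      have : 0 < n := by omega
      exact_mod_cast this.ne'
    rw [Nat.cast_sub hi.le]; field_simp
  rw [this]
  exact boundaryPoint_mem_corners (by omega) _

lemma mirrorHomeo_image_corners (n : ℕ) : mirrorHomeo '' corners n = corners n := by
  apply Set.Subset.antisymm
  · rintro _ ⟨z, hz, rfl⟩
    exact mirror_mem_corners hz
  · intro z hz
    exact ⟨Spindle.mirror z, mirror_mem_corners hz, mirror_mirror z⟩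

lemma polygonIso_wordInv (w : List Letter) : PolygonIso w (wordInv w) := by
  refine ⟨mirrorHomeo, fun z x s => ⟨HasLabel.mirror, fun h => ?_⟩, ?_⟩
  · have := HasLabel.mirror h
    change HasLabel _ (mirror (mirror z)) _ _ at this
    rwa [mirror_mirror, wordInv_wordInv] at this
  · rw [mirrorHomeo_image_corners, length_wordInv]

lemma units_smul_relabel {ρ : Letter → Letter} (hρ : ∀ x, ρ x.inv = (ρ x).inv) (ε : ℤˣ)
    (x : Letter) : ρ (x.1, ε * x.2) = ((ρ x).1, ε * (ρ x).2) := by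
  rcases Int.units_eq_one_or ε with rfl | rfl
  · simp
  · simpa [Letter.inv] using hρ x

lemma HasLabel.relabel {ρ : Letter → Letter} (hρ : ∀ x, ρ x.inv = (ρ x).inv) {w : List Letter}
    {z : Polygon} {x : Letter} {s : I} (h : HasLabel w z x s) : HasLabel (w.map ρ) z (ρ x) s := by
  obtain ⟨i, ε, hi, rfl⟩ := h
  refine ⟨i, ε, ?_, by rw [List.length_map]⟩
  rw [List.getElem?_map, hi, Option.map_some, units_smul_relabel hρ]

lemma HasLabel.exists_of_relabel {ρ : Letter → Letter} (hρ : ∀ x, ρ x.inv = (ρ x).inv)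
    {w : List Letter} {z : Polygon} {y : Letter} {s : I} (h : HasLabel (w.map ρ) z y s) :
    ∃ x, ρ x = y ∧ HasLabel w z x s := by
  obtain ⟨i, ε, hi, rfl⟩ := h
  rw [List.getElem?_map, Option.map_eq_some_iff] at hi
  obtain ⟨x, hx, hxy⟩ := hi
  have hεε : ε * ε = 1 := Int.units_mul_self ε
  refine ⟨(x.1, ε * x.2), ?_, i, ε, ?_, by rw [List.length_map]⟩
  · rw [units_smul_relabel hρ, hxy]
    simp [← mul_assoc, hεε]
  · simp [← mul_assoc, hεε, hx]

lemma labelRel_relabel_iff {Z : Type*} {L L' : Z → Letter → I → Prop} {ρ : Letter → Letter}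
    (hinj : Function.Injective ρ) (h₁ : ∀ z x s, L z x s → L' z (ρ x) s)
    (h₂ : ∀ z y s, L' z y s → ∃ x, ρ x = y ∧ L z x s) (z z' : Z) :
    LabelRel L z z' ↔ LabelRel L' z z' := by
  constructor
  · rintro ⟨x, s, h, h'⟩
    exact ⟨ρ x, s, h₁ _ _ _ h, h₁ _ _ _ h'⟩
  · rintro ⟨y, s, h, h'⟩
    obtain ⟨x, hx, h⟩ := h₂ _ _ _ h
    obtain ⟨x', hx', h'⟩ := h₂ _ _ _ h'
    obtain rfl : x = x' := hinj (hx.trans hx'.symm)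
    exact ⟨x, s, h, h'⟩

lemma wordEquiv_relabel {ρ : Letter → Letter} (hinj : Function.Injective ρ)
    (hρ : ∀ x, ρ x.inv = (ρ x).inv) (w : List Letter) : WordEquiv w (w.map ρ) :=
  .of_homeomorph (Homeomorph.refl _)
    (labelRel_relabel_iff hinj (fun _ _ _ h => h.relabel hρ)
      fun _ _ _ h => h.exists_of_relabel hρ) (by simp)

lemma pairEquiv_relabel {ρ : Letter → Letter} (hinj : Function.Injective ρ)
    (hρ : ∀ x, ρ x.inv = (ρ x).inv) (u v : List Letter) :
    PairEquiv u v (u.map ρ) (v.map ρ) := by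
  refine .of_homeomorph (Homeomorph.refl _) (labelRel_relabel_iff hinj ?_ ?_) (by simp)
  · rintro (z | z) x s h
    · exact HasLabel.relabel hρ h
    · exact HasLabel.relabel hρ h
  · rintro (z | z) y s h
    · exact HasLabel.exists_of_relabel hρ h
    · exact HasLabel.exists_of_relabel hρ h

lemma pairEquiv_swap (u v : List Letter) : PairEquiv u v v u := by
  refine .of_homeomorph (Homeomorph.sumComm _ _) (fun z z' => ?_) ?_
  · have key : ∀ z x s, HasLabel₂ u v z x s ↔
        HasLabel₂ v u (Homeomorph.sumComm Polygon Polygon z) x s := by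
      rintro (z | z) x s <;> rfl
    simp only [LabelRel, key]
  · rw [corners₂, corners₂, Set.image_union, Set.image_image, Set.image_image, Set.union_comm]
    rfl

lemma HasLabel.exists_mem {w : List Letter} {z : Polygon} {x : Letter} {s : I}
    (h : HasLabel w z x s) : ∃ y ∈ w, y.1 = x.1 := by
  obtain ⟨i, ε, hi, -⟩ := h
  exact ⟨_, List.mem_of_getElem? hi, rfl⟩

/-! ### Cutting and gluing polygons. -/

/-- Two polygons that share an edge with the letter `c` are glued along this edge. -/
lemma merge_markedHomeo {u v : List Letter} (hu : u ≠ []) (hv : v ≠ []) {c : Letter}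
    (hcu : Avoids c.1 u) (hcv : Avoids c.1 v) :
    MarkedHomeo (LabelRel (HasLabel₂ (u ++ [c]) (c.inv :: v)))
      (corners₂ (u ++ [c]).length (c.inv :: v).length)
      (LabelRel (HasLabel (u ++ v))) (corners (u ++ v).length) := by
  have hp := List.length_pos_iff.2 hu
  have hq := List.length_pos_iff.2 hv
  obtain ⟨F, hF, hsurj, F1, F2, F3, F4, F5, F6⟩ := exists_merge hp hq
  have mem : ∀ τ : I, (0 : ℝ) ≤ τ ∧ (τ : ℝ) ≤ 1 := fun τ => τ.2
  have E1 : ∀ (i : ℕ) (ε : ℤˣ) (s : I), i < u.length →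
      F (Sum.inl (edgePoint (u ++ [c]).length i ε s)) = edgePoint (u ++ v).length i ε s := by
    intro i ε s hi
    have hi' : (i + 1 : ℝ) ≤ u.length := by exact_mod_cast hi
    obtain ⟨h0, h1⟩ := mem (signParam ε s)
    have := F1 (i + signParam ε s) (by positivity) (by linarith)
    simpa [edgePoint] using this
  have E2 : ∀ (j : ℕ) (ε : ℤˣ) (s : I), j < v.length →
      F (Sum.inr (edgePoint (c.inv :: v).length (j + 1) ε s)) =
        edgePoint (u ++ v).length (u.length + j) ε s := by
    intro j ε s hj
    have hj' : (j + 1 : ℝ) ≤ v.length := by exact_mod_cast hj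
    obtain ⟨h0, h1⟩ := mem (signParam ε s)
    have := F2 (j + signParam ε s) (by positivity) (by linarith)
    simp only [edgePoint, List.length_cons, List.length_append]
    push_cast
    rw [add_right_comm, this, add_assoc]
  have E3 : ∀ (ε : ℤˣ) (s : I), F (Sum.inl (edgePoint (u ++ [c]).length u.length ε s)) =
      F (Sum.inr (edgePoint (c.inv :: v).length 0 (-ε) s)) := by
    intro ε s
    obtain ⟨h0, h1⟩ := mem (signParam ε s)
    have := F3 (signParam ε s) h0 h1
    simpa [edgePoint, signParam_neg] using this
  have C0 : ∀ n i : ℕ, boundaryPoint (i / n) = edgePoint n i 1 0 := by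
    intro n i; simp [edgePoint]
  have C1 : ∀ n i : ℕ, boundaryPoint ((i + 1 : ℕ) / n) = edgePoint n i 1 1 := by
    intro n i; simp [edgePoint]
  -- A label either survives on the merged polygon or belongs to the letter of `c`. In the second
  -- case the label alone determines `F z`, so points sharing such a label have the same image.
  have lab : ∀ z x s, HasLabel₂ (u ++ [c]) (c.inv :: v) z x s →
      HasLabel (u ++ v) (F z) x s ∨
      (x.1 = c.1 ∧ F z = F (Sum.inl (edgePoint (u ++ [c]).length u.length (c.2 * x.2) s))) := by
    rintro (z | z) x s ⟨i, ε, hi, rfl⟩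
    · by_cases hiu : i < u.length
      · left
        refine ⟨i, ε, ?_, E1 i ε s hiu⟩
        rw [List.getElem?_append_left hiu] at hi ⊢
        exact hi
      · right
        have hi' := (List.getElem?_eq_some_iff.1 hi).1
        obtain rfl : i = u.length := by simp at hi'; omega
        simp only [List.getElem?_concat_length, Option.some.injEq] at hi
        have h2 : c.2 * x.2 = ε := by
          rw [hi]; simp only; rw [mul_assoc, Int.units_mul_self, mul_one]
        exact ⟨by rw [hi], by rw [h2]⟩
    · cases i with
      | zero =>
        right
        simp only [List.getElem?_cons_zero, Option.some.injEq] at hi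
        have h1 : c.1 = x.1 := by simpa using congrArg Prod.fst hi
        have h2 : -c.2 = ε * x.2 := by simpa using congrArg Prod.snd hi
        have h3 : c.2 * x.2 = -ε := by
          rw [← neg_neg c.2, h2, neg_mul, mul_assoc, Int.units_mul_self, mul_one]
        exact ⟨h1.symm, by rw [h3, E3, neg_neg]⟩
      | succ j =>
        left
        rw [List.getElem?_cons_succ] at hi
        have hj := (List.getElem?_eq_some_iff.1 hi).1
        refine ⟨u.length + j, ε, ?_, E2 j ε s hj⟩
        rw [List.getElem?_append_right (by omega), ← hi]
        congr 1; omega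
  have lift : ∀ y x s, HasLabel (u ++ v) y x s →
      ∃ z, F z = y ∧ HasLabel₂ (u ++ [c]) (c.inv :: v) z x s := by
    rintro y x s ⟨i, ε, hi, rfl⟩
    have hi' := (List.getElem?_eq_some_iff.1 hi).1
    rw [List.length_append] at hi'
    by_cases hiu : i < u.length
    · refine ⟨Sum.inl (edgePoint (u ++ [c]).length i ε s), E1 i ε s hiu, i, ε, ?_, rfl⟩
      rw [List.getElem?_append_left hiu] at hi ⊢
      exact hi
    · push Not at hiu
      obtain ⟨j, rfl⟩ := Nat.exists_eq_add_of_le hiu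
      refine ⟨Sum.inr (edgePoint (c.inv :: v).length (j + 1) ε s), E2 j ε s (by omega),
        j + 1, ε, ?_, rfl⟩
      rw [List.getElem?_append_right (by omega)] at hi
      rw [List.getElem?_cons_succ, ← hi]
      congr 1; omega
  -- `F` identifies only points of the glued edge, and these already share a label with letter `c`.
  have ker : ∀ z z', F z = F z' →
      Quot.mk (LabelRel (HasLabel₂ (u ++ [c]) (c.inv :: v))) z = Quot.mk _ z' := by
    have aux : ∀ z z', F (Sum.inl z) = F (Sum.inr z') →
        Quot.mk (LabelRel (HasLabel₂ (u ++ [c]) (c.inv :: v))) (Sum.inl z) =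
          Quot.mk _ (Sum.inr z') := by
      intro z z' h
      obtain ⟨t, h0, h1, rfl, rfl⟩ := F6 z z' h
      refine Quot.sound ⟨c, ⟨t, h0, h1⟩, ⟨u.length, 1, by simp, ?_⟩, ⟨0, -1, ?_, ?_⟩⟩
      · simp [edgePoint]
      · simp [Letter.inv]
      · simp [edgePoint]
    rintro (z | z) (z' | z') h
    · rw [F4 z z' h]
    · exact aux z z' h
    · exact (aux z' z h.symm).symm
    · rw [F5 z z' h]
  have avoid : ∀ {y x s}, HasLabel (u ++ v) y x s → x.1 ≠ c.1 := by
    intro y x s h hx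
    obtain ⟨l, hl, hl'⟩ := h.exists_mem
    rcases List.mem_append.1 hl with hl | hl
    · exact hcu l hl (hl'.trans hx)
    · exact hcv l hl (hl'.trans hx)
  refine .of_isQuotientMap (hF.isClosedMap.isQuotientMap hF hsurj) ?_ ker ?_ ?_
  · rintro z z' ⟨x, s, h, h'⟩
    rcases lab z x s h with h | ⟨h, e⟩ <;> rcases lab z' x s h' with h' | ⟨h', e'⟩
    · exact Quot.sound ⟨x, s, h, h'⟩
    · exact absurd h' (avoid h)
    · exact absurd h (avoid h')
    · rw [e, e']
  · rintro z z' ⟨x, s, h, h'⟩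
    obtain ⟨z₁, e, h⟩ := lift _ _ _ h
    obtain ⟨z₁', e', h'⟩ := lift _ _ _ h'
    rw [← ker _ _ e, ← ker _ _ e']
    exact Quot.sound ⟨x, s, h, h'⟩
  · have hpos : 0 < (u ++ v).length := by simp; omega
    have K0 : ∀ i, edgePoint (u ++ v).length i 1 0 ∈ corners (u ++ v).length := by
      intro i; rw [← C0]; exact boundaryPoint_mem_corners hpos _
    have K1 : ∀ i, edgePoint (u ++ v).length i 1 1 ∈ corners (u ++ v).length := by
      intro i; rw [← C1]; exact boundaryPoint_mem_corners hpos _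
    apply Set.Subset.antisymm
    · rintro _ ⟨_, ⟨z, ⟨i, hi, rfl⟩, rfl⟩ | ⟨z, ⟨i, hi, rfl⟩, rfl⟩, rfl⟩
      · rw [List.length_append, List.length_singleton] at hi
        by_cases hiu : i < u.length
        · rw [C0, E1 _ _ _ hiu]; exact K0 i
        -- The starting corner of the glued edge is also the end of the last edge of `u`, which
        -- survives the gluing; `u` is nonempty.
        · obtain rfl : i = (u.length - 1) + 1 := by omega
          rw [C1, E1 _ _ _ (by omega)]; exact K1 _
      · rw [List.length_cons] at hi
        cases i with
        -- Corner 0 starts the glued edge, so it is reached instead, around the circle, as the end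
        -- of the last edge of `v`.
        | zero =>
          have : boundaryPoint ((0 : ℕ) / (c.inv :: v).length) =
              boundaryPoint ((v.length - 1 + 1 + 1 : ℕ) / (c.inv :: v).length) := by
            have e : v.length - 1 + 1 + 1 = (c.inv :: v).length := by simp; omega
            have hne : ((c.inv :: v).length : ℝ) ≠ 0 := by
              simp only [List.length_cons]; positivity
            rw [e, div_self hne, Nat.cast_zero, zero_div, ← boundaryPoint_add_one, zero_add]
          rw [this, C1, E2 _ _ _ (by omega)]; exact K1 _
        | succ j => rw [C0, E2 _ _ _ (by omega)]; exact K0 _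
    · rintro _ ⟨i, hi, rfl⟩
      rw [List.length_append] at hi
      rw [C0]
      by_cases hiu : i < u.length
      · rw [← E1 _ _ _ hiu, ← C0]
        exact ⟨_, Or.inl ⟨_, boundaryPoint_mem_corners (by simp) _, rfl⟩, rfl⟩
      · push Not at hiu
        obtain ⟨j, rfl⟩ := Nat.exists_eq_add_of_le hiu
        rw [← E2 _ _ _ (by omega), ← C0]
        exact ⟨_, Or.inr ⟨_, boundaryPoint_mem_corners (by simp) _, rfl⟩, rfl⟩

lemma exists_fresh_letter (w : List Letter) : ∃ c : ℕ, Avoids c w := by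
  obtain ⟨c, hc⟩ := Infinite.exists_notMem_finset (w.map Prod.fst).toFinset
  refine ⟨c, fun x hx h => hc ?_⟩
  rw [List.mem_toFinset, List.mem_map]
  exact ⟨x, hx, h⟩

/-- Interchange of two letters. -/
def swapLetters (a b : ℕ) (x : Letter) : Letter := (Equiv.swap a b x.1, x.2)

lemma map_swapLetters_of_avoids {a b : ℕ} {w : List Letter} (ha : Avoids a w) (hb : Avoids b w) :
    w.map (swapLetters a b) = w := by
  conv_rhs => rw [← List.map_id w]
  refine List.map_congr_left fun x hx => ?_
  rw [swapLetters, Equiv.swap_apply_of_ne_of_ne (ha x hx) (hb x hx)]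
  rfl

lemma wordEquiv_swapLetters (a b : ℕ) (w : List Letter) :
    WordEquiv w (w.map (swapLetters a b)) :=
  wordEquiv_relabel (ρ := swapLetters a b) (fun x y h => by
    simp only [swapLetters, Prod.mk.injEq, EmbeddingLike.apply_eq_iff_eq] at h
    exact Prod.ext h.1 h.2) (fun _ => rfl) w

/-- Inversion of the letter `a`. -/
def flipLetter (a : ℕ) (x : Letter) : Letter := if x.1 = a then x.inv else x

lemma wordEquiv_flipLetter (a : ℕ) (w : List Letter) : WordEquiv w (w.map (flipLetter a)) := by
  refine wordEquiv_relabel (Function.LeftInverse.injective (g := flipLetter a) fun x => ?_)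
    (fun x => ?_) w
  · by_cases h : x.1 = a <;> simp [flipLetter, h]
  · by_cases h : x.1 = a <;> simp [flipLetter, h]

/-- Cutting along a new edge and gluing along the edge `x`, when the letter `x` occurs twice in
the same direction. -/
lemma wordEquiv_cross {x : Letter} {u v : List Letter} (hu : Avoids x.1 u) (hv : Avoids x.1 v) :
    WordEquiv ((x :: u) ++ (x :: v)) (x :: x :: (wordInv u ++ v)) := by
  obtain ⟨c, hc⟩ := exists_fresh_letter ((x :: u) ++ (x :: v))
  simp only [avoids_append, avoids_cons] at hc
  obtain ⟨⟨hxc, hcu⟩, -, hcv⟩ := hc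
  -- Cut x u x v into x u y⁻¹ and y x v, turn these into y u⁻¹ x⁻¹ and x v y, and glue along x to y
  -- u⁻¹ v y. Rotating gives y y u⁻¹ v, in which y is renamed.
  set y : Letter := (c, -1) with hy
  have s1 := (merge_markedHomeo (u := x :: u) (v := x :: v) (by simp) (by simp) (c := y.inv)
    (by simp [y, hxc, hcu]) (by simp [y, hxc, hcv])).symm
  rw [Letter.inv_inv] at s1
  have s2 : PairEquiv ((x :: u) ++ [y.inv]) (y :: x :: v) ((y :: wordInv u) ++ [x.inv])
      (x.inv.inv :: (v ++ [y])) := by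
    refine PolygonIso.pairEquiv ?_ ?_
    · have := polygonIso_wordInv ((x :: u) ++ [y.inv])
      simpa using this
    · rw [Letter.inv_inv]
      exact polygonIso_rotate [y] (x :: v)
  have s3 := merge_markedHomeo (u := y :: wordInv u) (v := v ++ [y]) (by simp) (by simp)
    (c := x.inv) (by simp [y, hxc.symm, hu]) (by simp [y, hxc.symm, hv])
  have s4 : WordEquiv ((y :: wordInv u) ++ (v ++ [y])) (y :: y :: (wordInv u ++ v)) := by
    have := (polygonIso_rotate ((y :: wordInv u) ++ v) [y]).wordEquiv
    simpa using this
  have s5 := wordEquiv_swapLetters x.1 c (y :: y :: (wordInv u ++ v))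
  have e5 : (y :: y :: (wordInv u ++ v)).map (swapLetters x.1 c) =
      (x.1, -1) :: (x.1, -1) :: (wordInv u ++ v) := by
    have h := map_swapLetters_of_avoids (a := x.1) (b := c) (w := wordInv u ++ v)
      (by simp [hu, hv]) (by simp [hcu, hcv])
    rw [List.map_cons, List.map_cons, h]
    simp [swapLetters, y]
  rw [e5] at s5
  have s6 : WordEquiv ((x.1, -1) :: (x.1, -1) :: (wordInv u ++ v)) (x :: x :: (wordInv u ++ v)) := by
    rcases Int.units_eq_one_or x.2 with h | h
    · have := wordEquiv_flipLetter x.1 ((x.1, -1) :: (x.1, -1) :: (wordInv u ++ v))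
      have e : (wordInv u ++ v).map (flipLetter x.1) = wordInv u ++ v := by
        conv_rhs => rw [← List.map_id (wordInv u ++ v)]
        refine List.map_congr_left fun z hz => ?_
        have : Avoids x.1 (wordInv u ++ v) := by simp [hu, hv]
        simp [flipLetter, this z hz]
      rw [List.map_cons, List.map_cons, e] at this
      simpa [flipLetter, Letter.inv, ← h] using this
    · rw [← h]; exact MarkedHomeo.refl _ _
  exact s1.trans (s2.trans (s3.trans (s4.trans (s5.trans s6))))

/-- Cutting along a new edge and gluing along the edge `x`, when the letter `x` occurs twice in
opposite directions. -/
lemma wordEquiv_slide {x : Letter} {u v w : List Letter} (hu : Avoids x.1 u) (hv : Avoids x.1 v)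
    (hw : Avoids x.1 w) :
    WordEquiv ((x :: u) ++ (x.inv :: v) ++ w) ((x :: u) ++ (x.inv :: w) ++ v) := by
  obtain ⟨c, hc⟩ := exists_fresh_letter ((x :: u) ++ (x.inv :: v) ++ w)
  simp only [avoids_append, avoids_cons] at hc
  obtain ⟨⟨⟨hxc, hcu⟩, -, hcv⟩, hcw⟩ := hc
  -- Cut w x u x⁻¹ v into w x u y⁻¹ and y x⁻¹ v, rotate these to u y⁻¹ w x and x⁻¹ v y, and glue
  -- along x to u y⁻¹ w v y. Rotating gives y u y⁻¹ w v. With the sign `x.2`, exchanging the letters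
  -- turns y exactly into x.
  set y : Letter := (c, x.2) with hy
  have s0 : WordEquiv ((x :: u) ++ (x.inv :: v) ++ w) ((w ++ x :: u) ++ (x.inv :: v)) := by
    have := (polygonIso_rotate ((x :: u) ++ (x.inv :: v)) w).wordEquiv
    simpa using this
  have s1 := (merge_markedHomeo (u := w ++ x :: u) (v := x.inv :: v) (by simp) (by simp)
    (c := y.inv) (by simp [y, hxc, hcu, hcw]) (by simp [y, hxc, hcv])).symm
  rw [Letter.inv_inv] at s1
  have s2 : PairEquiv ((w ++ x :: u) ++ [y.inv]) (y :: x.inv :: v) ((u ++ y.inv :: w) ++ [x])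
      (x.inv :: (v ++ [y])) := by
    refine PolygonIso.pairEquiv ?_ ?_
    · have := polygonIso_rotate (w ++ [x]) (u ++ [y.inv])
      simpa using this
    · exact polygonIso_rotate [y] (x.inv :: v)
  have s3 := merge_markedHomeo (u := u ++ y.inv :: w) (v := v ++ [y]) (by simp) (by simp)
    (c := x) (by simp [y, hxc.symm, hu, hw]) (by simp [y, hxc.symm, hv])
  have s4 : WordEquiv ((u ++ y.inv :: w) ++ (v ++ [y])) ((y :: u) ++ (y.inv :: w) ++ v) := by
    have := (polygonIso_rotate (u ++ y.inv :: (w ++ v)) [y]).wordEquiv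
    simpa using this
  have s5 := wordEquiv_swapLetters x.1 c ((y :: u) ++ (y.inv :: w) ++ v)
  have e5 : ((y :: u) ++ (y.inv :: w) ++ v).map (swapLetters x.1 c) =
      (x :: u) ++ (x.inv :: w) ++ v := by
    simp only [List.map_append, List.map_cons, map_swapLetters_of_avoids hu hcu,
      map_swapLetters_of_avoids hv hcv, map_swapLetters_of_avoids hw hcw]
    simp [swapLetters, y, Letter.inv]
  rw [e5] at s5
  exact s0.trans (s1.trans (s2.trans (s3.trans (s4.trans s5))))

end Spindle

namespace Spindle

open Set Topology unitInterval

/-! ### Combinatorial cut and paste of words. -/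

/-- The number of occurrences of the letter `a`, in either direction. -/
def letterCount (a : ℕ) (w : List Letter) : ℕ := (w.map Prod.fst).count a

@[simp] lemma letterCount_nil (a : ℕ) : letterCount a [] = 0 := rfl

@[simp] lemma letterCount_append (a : ℕ) (u v : List Letter) :
    letterCount a (u ++ v) = letterCount a u + letterCount a v := by
  simp [letterCount]

/-- The number of occurrences of `a` in a one-letter word with letter `b`. -/
def letterHit (a b : ℕ) : ℕ := if b = a then 1 else 0

@[simp] lemma letterHit_self (a : ℕ) : letterHit a a = 1 := if_pos rfl

lemma letterHit_of_ne {a b : ℕ} (h : b ≠ a) : letterHit a b = 0 := if_neg h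

@[simp] lemma letterCount_cons (a : ℕ) (x : Letter) (v : List Letter) :
    letterCount a (x :: v) = letterHit a x.1 + letterCount a v := by
  simp [letterCount, letterHit, List.count_cons, add_comm]

@[simp] lemma letterCount_wordInv (a : ℕ) (w : List Letter) :
    letterCount a (wordInv w) = letterCount a w := by
  induction w with
  | nil => rfl
  | cons x w ih => simp [ih, add_comm]

lemma letterCount_eq_zero {a : ℕ} {w : List Letter} : letterCount a w = 0 ↔ Avoids a w := by
  rw [letterCount, List.count_eq_zero]
  simp only [Avoids, List.mem_map, not_exists, not_and]

@[simp] lemma letterCount_flipLetter (a b : ℕ) (w : List Letter) :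
    letterCount a (w.map (flipLetter b)) = letterCount a w := by
  induction w with
  | nil => rfl
  | cons x w ih =>
    have : (flipLetter b x).1 = x.1 := by unfold flipLetter; split_ifs <;> rfl
    simp [ih, this]

lemma eq_nil_of_letterCount {w : List Letter} (h : ∀ a, letterCount a w = 0) : w = [] := by
  cases w with
  | nil => rfl
  | cons x w => simpa using h x.1

lemma exists_split {a : ℕ} {w : List Letter} (h : letterCount a w = 1) :
    ∃ u y v, w = u ++ y :: v ∧ y.1 = a ∧ Avoids a u ∧ Avoids a v := by
  have : a ∈ w.map Prod.fst := List.count_pos_iff.1 (by rw [letterCount] at h; omega)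
  obtain ⟨y, hy, rfl⟩ := List.mem_map.1 this
  obtain ⟨u, v, rfl⟩ := List.append_of_mem hy
  simp only [letterCount_append, letterCount_cons, letterHit_self] at h
  exact ⟨u, y, v, rfl, rfl, letterCount_eq_zero.1 (by omega), letterCount_eq_zero.1 (by omega)⟩

lemma Letter.eq_or_eq_inv {x y : Letter} (h : y.1 = x.1) : y = x ∨ y = x.inv := by
  rcases Int.units_eq_one_or x.2 with hx | hx <;> rcases Int.units_eq_one_or y.2 with hy | hy
  · exact Or.inl (Prod.ext h (hy.trans hx.symm))
  · exact Or.inr (Prod.ext h (by simp [hx, hy]))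
  · exact Or.inr (Prod.ext h (by simp [hx, hy]))
  · exact Or.inl (Prod.ext h (hy.trans hx.symm))

lemma map_flipLetter_of_avoids {a : ℕ} {w : List Letter} (h : Avoids a w) :
    w.map (flipLetter a) = w := by
  conv_rhs => rw [← List.map_id w]
  refine List.map_congr_left fun x hx => ?_
  simp [flipLetter, h x hx]

/-- Cut-and-paste transformations of the boundary word of a polygon; only edges with letters less
than `k` are cut or glued. -/
inductive WordStep (k : ℕ) : List Letter → List Letter → Prop
  | rotate (u v : List Letter) : WordStep k (u ++ v) (v ++ u)
  | invert (w : List Letter) : WordStep k w (wordInv w)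
  | flip (a : ℕ) (ha : a < k) (w : List Letter) : WordStep k w (w.map (flipLetter a))
  | cross (x : Letter) (hx : x.1 < k) (u v : List Letter) (hu : Avoids x.1 u)
      (hv : Avoids x.1 v) : WordStep k ((x :: u) ++ (x :: v)) (x :: x :: (wordInv u ++ v))
  | slide (x : Letter) (hx : x.1 < k) (u v w : List Letter) (hu : Avoids x.1 u)
      (hv : Avoids x.1 v) (hw : Avoids x.1 w) :
      WordStep k ((x :: u) ++ (x.inv :: v) ++ w) ((x :: u) ++ (x.inv :: w) ++ v)

def WordSim (k : ℕ) : List Letter → List Letter → Prop := Relation.EqvGen (WordStep k)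

namespace WordSim

variable {k : ℕ} {u v w : List Letter}

lemma refl (w : List Letter) : WordSim k w w := Relation.EqvGen.refl _

lemma symm (h : WordSim k u v) : WordSim k v u := Relation.EqvGen.symm _ _ h

lemma trans (h : WordSim k u v) (h' : WordSim k v w) : WordSim k u w := Relation.EqvGen.trans _ _ _ h h'

lemma rotate (u v : List Letter) : WordSim k (u ++ v) (v ++ u) := .rel _ _ (.rotate u v)

lemma invert (w : List Letter) : WordSim k w (wordInv w) := .rel _ _ (.invert w)

lemma flip {a : ℕ} (ha : a < k) (w : List Letter) : WordSim k w (w.map (flipLetter a)) :=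
  .rel _ _ (.flip a ha w)

lemma cross {x : Letter} (hx : x.1 < k) (hu : Avoids x.1 u) (hv : Avoids x.1 v) :
    WordSim k ((x :: u) ++ (x :: v)) (x :: x :: (wordInv u ++ v)) :=
  .rel _ _ (.cross x hx u v hu hv)

lemma slide {x : Letter} (hx : x.1 < k) (hu : Avoids x.1 u) (hv : Avoids x.1 v)
    (hw : Avoids x.1 w) :
    WordSim k ((x :: u) ++ (x.inv :: v) ++ w) ((x :: u) ++ (x.inv :: w) ++ v) :=
  .rel _ _ (.slide x hx u v w hu hv hw)

/-- The slide for x⁻¹, conjugated by a rotation: on the circle, the segments on either side of the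
pair x, x⁻¹ play the same role. -/
lemma slide_inside {x : Letter} (hx : x.1 < k) (hu : Avoids x.1 u) (hv : Avoids x.1 v)
    (hw : Avoids x.1 w) :
    WordSim k ((x :: (u ++ v)) ++ (x.inv :: w)) ((x :: (v ++ u)) ++ (x.inv :: w)) := by
  have h := slide (x := x.inv) (k := k) hx (u := w) (v := u) (w := v) hw hu hv
  rw [Letter.inv_inv] at h
  have h1 : WordSim k ((x :: (u ++ v)) ++ (x.inv :: w)) ((x.inv :: w) ++ (x :: u) ++ v) := by
    simpa using rotate (x :: (u ++ v)) (x.inv :: w)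
  have h2 : WordSim k ((x.inv :: w) ++ (x :: v) ++ u) ((x :: (v ++ u)) ++ (x.inv :: w)) := by
    simpa using rotate (x.inv :: w) (x :: (v ++ u))
  exact h1.trans (h.trans h2)

lemma letterCount_eq (a : ℕ) (h : WordSim k u v) : letterCount a u = letterCount a v := by
  induction h with
  | rel u v h =>
    cases h <;> simp <;> omega
  | refl => rfl
  | symm _ _ _ ih => exact ih.symm
  | trans _ _ _ _ _ ih ih' => exact ih.trans ih'

lemma length_eq (h : WordSim k u v) : u.length = v.length := by
  induction h with
  | rel u v h =>
    cases h <;> simp <;> omega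
  | refl => rfl
  | symm _ _ _ ih => exact ih.symm
  | trans _ _ _ _ _ ih ih' => exact ih.trans ih'

lemma avoids_iff {a : ℕ} (h : WordSim k u v) : Avoids a u ↔ Avoids a v := by
  rw [← letterCount_eq_zero, ← letterCount_eq_zero, h.letterCount_eq]

lemma wordEquiv (h : WordSim k u v) : WordEquiv u v := by
  induction h with
  | rel u v h =>
    cases h with
    | rotate u v => exact (polygonIso_rotate u v).wordEquiv
    | invert => exact (polygonIso_wordInv u).wordEquiv
    | flip a ha => exact wordEquiv_flipLetter a u
    | cross x hx u v hu hv => exact wordEquiv_cross hu hv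
    | slide x hx u v w hu hv hw => exact wordEquiv_slide hu hv hw
  | refl => exact MarkedHomeo.refl _ _
  | symm _ _ _ ih => exact ih.symm
  | trans _ _ _ _ _ ih ih' => exact ih.trans ih'

/-- Letters from k on are carried along passively by every step, so words can be substituted for
them. The images must avoid the letters below k, since the steps require the segments around x to
avoid x. -/
lemma flatMap {f : Letter → List Letter} (hinv : ∀ x, f x.inv = wordInv (f x))
    (hlt : ∀ x : Letter, x.1 < k → f x = [x])
    (hge : ∀ x : Letter, k ≤ x.1 → ∀ a < k, Avoids a (f x)) (h : WordSim k u v) :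
    WordSim k (u.flatMap f) (v.flatMap f) := by
  have hw : ∀ w : List Letter, (wordInv w).flatMap f = wordInv (w.flatMap f) := by
    intro w
    induction w with
    | nil => rfl
    | cons x w ih => simp [ih, hinv]
  have havoid : ∀ a < k, ∀ w : List Letter, Avoids a w → Avoids a (w.flatMap f) := by
    intro a ha w
    induction w with
    | nil => simp
    | cons x w ih =>
      simp only [avoids_cons, List.flatMap_cons, avoids_append]
      rintro ⟨h1, h2⟩
      refine ⟨?_, ih h2⟩
      rcases lt_or_ge x.1 k with hx | hx
      · simpa [hlt x hx] using h1
      · exact hge x hx a ha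
  have hflip : ∀ a < k, ∀ w : List Letter,
      (w.map (flipLetter a)).flatMap f = (w.flatMap f).map (flipLetter a) := by
    intro a ha w
    induction w with
    | nil => rfl
    | cons x w ih =>
      simp only [List.map_cons, List.flatMap_cons, ih, List.map_append]
      congr 1
      rcases lt_or_ge x.1 k with hx | hx
      · rw [hlt x hx, hlt]
        · rfl
        · unfold flipLetter; split_ifs <;> exact hx
      · rw [map_flipLetter_of_avoids (hge x hx a ha), flipLetter, if_neg (by omega)]
  induction h with
  | rel u v h =>
    cases h with
    | rotate u v => simpa using rotate (u.flatMap f) (v.flatMap f)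
    | invert => rw [hw]; exact invert _
    | flip a ha => rw [hflip a ha]; exact flip ha _
    | cross x hx u v hu hv =>
      have := cross hx (havoid _ hx u hu) (havoid _ hx v hv)
      simpa [hlt x hx, hw] using this
    | slide x hx u v w hu hv hw =>
      have := slide hx (havoid _ hx u hu) (havoid _ hx v hv) (havoid _ hx w hw)
      have hx' : f x.inv = [x.inv] := hlt x.inv hx
      simpa [hlt x hx, hx'] using this
  | refl => exact refl _
  | symm _ _ _ ih => exact ih.symm
  | trans _ _ _ _ _ ih ih' => exact ih.trans ih'

/-- The classical collection of a handle from two linked pairs: slides move u₁ past y inside the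
pair of x, then x⁻¹ v₁ to the front inside the pair of y, and finally v₁ u₂ u₁ past y⁻¹ v₂ behind
x⁻¹. -/
lemma handle {x y : Letter} (hx : x.1 < k) (hy : y.1 < k) (hxy : x.1 ≠ y.1)
    {u₁ u₂ v₁ v₂ : List Letter} (hx₁ : Avoids x.1 u₁) (hx₂ : Avoids x.1 u₂) (hx₃ : Avoids x.1 v₁)
    (hx₄ : Avoids x.1 v₂) (hy₁ : Avoids y.1 u₁) (hy₂ : Avoids y.1 u₂) (hy₃ : Avoids y.1 v₁)
    (hy₄ : Avoids y.1 v₂) :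
    WordSim k (x :: u₁ ++ y :: u₂ ++ x.inv :: v₁ ++ y.inv :: v₂)
      ([x, y, x.inv, y.inv] ++ (v₂ ++ v₁ ++ u₂ ++ u₁)) := by
  have s1 := slide_inside hx (u := u₁) (v := y :: u₂) (w := v₁ ++ y.inv :: v₂) hx₁
    (by simp [hx₂, hxy.symm]) (by simp [hx₃, hx₄, hxy.symm])
  have s2 := rotate (k := k) [x] (y :: (u₂ ++ u₁ ++ x.inv :: v₁ ++ y.inv :: v₂))
  have s3 := slide_inside hy (u := u₂ ++ u₁) (v := x.inv :: v₁) (w := v₂ ++ [x])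
    (by simp [hy₁, hy₂]) (by simp [hy₃, hxy]) (by simp [hy₄, hxy])
  have s4 := rotate (k := k) (y :: x.inv :: (v₁ ++ u₂ ++ u₁ ++ y.inv :: v₂)) [x]
  have s5 := slide hx (u := [y]) (v := v₁ ++ u₂ ++ u₁) (w := y.inv :: v₂)
    (by simp [hxy.symm]) (by simp [hx₁, hx₂, hx₃]) (by simp [hx₄, hxy.symm])
  simp only [List.append_assoc, List.cons_append, List.nil_append] at s1 s2 s3 s4 s5 ⊢
  exact s1.trans (s2.trans (s3.trans (s4.trans s5)))

end WordSim

/-! ### Blocks as connected summands. -/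

/-- The words of a crosscap, of an edge with a free vertex, and of a handle. -/
inductive IsBlock (k : ℕ) : List Letter → Prop
  | crosscap (x : Letter) (hx : x.1 < k) : IsBlock k [x, x]
  | spur (x : Letter) (hx : x.1 < k) : IsBlock k [x, x.inv]
  | handle (x y : Letter) (hx : x.1 < k) (hy : y.1 < k) (hxy : x.1 ≠ y.1) :
      IsBlock k [x, y, x.inv, y.inv]

namespace IsBlock

variable {k : ℕ} {T : List Letter}

lemma lt (hT : IsBlock k T) : ∀ x ∈ T, x.1 < k := by
  cases hT <;> simp_all

lemma letterCount (hT : IsBlock k T) (a : ℕ) : letterCount a T = 0 ∨ letterCount a T = 2 := by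
  cases hT with
  | crosscap x hx => by_cases h : x.1 = a <;> simp [letterHit, h]
  | spur x hx => by_cases h : x.1 = a <;> simp [letterHit, h]
  | handle x y hx hy hxy =>
    by_cases h : x.1 = a
    · have : y.1 ≠ a := fun h' => hxy (h.trans h'.symm)
      simp [letterHit, h, this]
    · by_cases h' : y.1 = a <;> simp [letterHit, h, h']

lemma length_pos (hT : IsBlock k T) : 0 < T.length := by
  cases hT <;> simp

/-- It does not matter where along the remaining boundary a block is attached. For a crosscap, x x u
v comes from x u⁻¹ x v, whose inverse is, up to rotation and a flip of x, x v⁻¹ x u, which gives x x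
v u. For a spur this is a slide. For a handle, v is inserted behind x and the handle is collected
again, first from the pairs of y and x⁻¹, then from those of x and y. -/
lemma move (hT : IsBlock k T) {u v : List Letter} (hu : ∀ x ∈ T, Avoids x.1 u)
    (hv : ∀ x ∈ T, Avoids x.1 v) : WordSim k (T ++ (u ++ v)) (T ++ (v ++ u)) := by
  cases hT with
  | crosscap x hx =>
    have hu := hu x (by simp)
    have hv := hv x (by simp)
    have s1 := (WordSim.cross hx (u := wordInv u) (v := v) (by simpa using hu) hv).symm
    have s2 := WordSim.invert (k := k) (x :: wordInv u ++ x :: v)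
    have s3 := WordSim.rotate (k := k) (wordInv v) (x.inv :: (u ++ [x.inv]))
    have s4 := WordSim.rotate (k := k) (x.inv :: u) (x.inv :: wordInv v)
    have s5 := WordSim.flip hx (x.inv :: wordInv v ++ x.inv :: u)
    have s6 := WordSim.cross hx (u := wordInv v) (v := u) (by simpa using hv) hu
    have e : flipLetter x.1 x.inv = x := by simp [flipLetter]
    have e' : (wordInv v).map (flipLetter x.1) = wordInv v :=
      map_flipLetter_of_avoids (by simpa using hv)
    simp only [List.map_append, List.map_cons, e, e', map_flipLetter_of_avoids hu,
      wordInv_append, wordInv_cons, wordInv_wordInv, List.append_assoc, List.cons_append,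
      List.nil_append] at s1 s2 s3 s4 s5 s6 ⊢
    exact s1.trans (s2.trans (s3.trans (s4.trans (s5.trans s6))))
  | spur x hx =>
    exact WordSim.slide hx (u := []) (by simp) (hu x (by simp)) (hv x (by simp))
  | handle x y hx hy hxy =>
    have hu1 := hu x (by simp)
    have hu2 := hu y (by simp)
    have hv1 := hv x (by simp)
    have hv2 := hv y (by simp)
    have s1 := (WordSim.handle hx hy hxy (u₁ := v) (u₂ := []) (v₁ := []) (v₂ := u) hv1 (by simp)
      (by simp) hu1 hv2 (by simp) (by simp) hu2).symm
    have s2 := WordSim.rotate (k := k) (x :: v) (y :: x.inv :: y.inv :: u)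
    have s3 := WordSim.handle (x := y) (y := x.inv) hy hx hxy.symm (u₁ := []) (u₂ := [])
      (v₁ := u) (v₂ := v) (by simp) (by simp) hu2 hv2 (by simp) (by simp) hu1 hv1
    have s4 := WordSim.rotate (k := k) [y, x.inv, y.inv] (x :: (v ++ u))
    have s5 := WordSim.handle hx hy hxy (u₁ := v ++ u) (u₂ := []) (v₁ := []) (v₂ := [])
      (by simp [hu1, hv1]) (by simp) (by simp) (by simp) (by simp [hu2, hv2]) (by simp) (by simp)
      (by simp)
    simp only [List.append_assoc, List.cons_append, List.nil_append, Letter.inv_inv,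
      List.append_nil] at s1 s2 s3 s4 s5 ⊢
    exact s1.trans (s2.trans (s3.trans (s4.trans s5)))

/-- Blocks are symmetric under reflection: a spur is its own inverse word, a crosscap needs a flip
of its letter, and a handle is collected again as x y⁻¹ x⁻¹ y before flipping y. -/
lemma inv_append (hT : IsBlock k T) {u : List Letter} (hu : ∀ x ∈ T, Avoids x.1 u) :
    WordSim k (wordInv T ++ u) (T ++ u) := by
  cases hT with
  | crosscap x hx =>
    have s := WordSim.flip hx ([x, x] ++ u)
    have hu := hu x (by simp)
    have e : flipLetter x.1 x = x.inv := by simp [flipLetter]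
    simpa [e, map_flipLetter_of_avoids hu] using s.symm
  | spur x hx => simpa using WordSim.refl _
  | handle x y hx hy hxy =>
    have hu1 := hu x (by simp)
    have hu2 := hu y (by simp)
    have s1 := WordSim.rotate (k := k) [y] (x :: y.inv :: x.inv :: u)
    have s2 := WordSim.handle (x := x) (y := y.inv) hx hy hxy (u₁ := []) (u₂ := [])
      (v₁ := u) (v₂ := []) (by simp) (by simp) hu1 (by simp) (by simp) (by simp) hu2 (by simp)
    have s3 := WordSim.flip hy ([x, y.inv, x.inv, y] ++ u)
    have e1 : flipLetter y.1 x = x := by simp [flipLetter, hxy]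
    have e2 : flipLetter y.1 x.inv = x.inv := by simp [flipLetter, hxy]
    have e3 : flipLetter y.1 y = y.inv := by simp [flipLetter]
    have e4 : flipLetter y.1 y.inv = y := by simp [flipLetter]
    simp only [List.cons_append, List.nil_append, Letter.inv_inv,
      List.append_nil, wordInv_cons, wordInv_nil, List.map_cons, e1, e2, e3, e4,
      map_flipLetter_of_avoids hu2] at s1 s2 s3 ⊢
    exact s1.trans (s2.trans s3)

/-- Each step on the rest can be performed in the presence of `T`. A rotation is `move`, and an
inversion also inverts `T`, which `inv_append` undoes. In a cross or slide `T` is absorbed into a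
free segment, and after a slide `move` brings it back. -/
lemma append_congr (hT : IsBlock k T) {u v : List Letter} (h : WordSim k u v)
    (hu : ∀ x ∈ T, Avoids x.1 u) : WordSim k (T ++ u) (T ++ v) := by
  induction h with
  | rel u v h =>
    cases h with
    | rotate u v =>
      simp only [avoids_append] at hu
      exact hT.move (fun x hx => (hu x hx).1) fun x hx => (hu x hx).2
    | invert =>
      have s1 := WordSim.invert (k := k) (T ++ u)
      rw [wordInv_append] at s1
      exact s1.trans ((WordSim.rotate _ _).trans
        (hT.inv_append fun x hx => avoids_wordInv.2 (hu x hx)))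
    | flip a ha =>
      by_cases h : Avoids a T
      · have := WordSim.flip ha (T ++ u)
        rwa [List.map_append, map_flipLetter_of_avoids h] at this
      · have : Avoids a u := by
          unfold Avoids at h
          push Not at h
          obtain ⟨x, hx, rfl⟩ := h
          exact hu x hx
        rw [map_flipLetter_of_avoids this]
        exact .refl _
    | cross x hx u v hxu hxv =>
      have hxT : Avoids x.1 T := fun y hy h => by
        have := hu y hy
        simp [h] at this
      have s1 := WordSim.rotate (k := k) T (x :: u ++ x :: v)
      have s2 := WordSim.cross hx (u := u) (v := v ++ T) hxu (by simp [hxv, hxT])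
      have s3 := WordSim.rotate (k := k) (x :: x :: (wordInv u ++ v)) T
      simp only [List.append_assoc, List.cons_append] at s1 s2 s3 ⊢
      exact s1.trans (s2.trans s3)
    | slide x hx u v w hxu hxv hxw =>
      have hxT : Avoids x.1 T := fun y hy h => by
        have := hu y hy
        simp [h] at this
      have s1 := WordSim.rotate (k := k) T (x :: u ++ x.inv :: v ++ w)
      have s2 := WordSim.slide hx (u := u) (v := v) (w := w ++ T) hxu hxv (by simp [hxw, hxT])
      have s3 := WordSim.rotate (k := k) (x :: u ++ x.inv :: w) (T ++ v)
      have s4 := hT.move (u := v) (v := x :: u ++ x.inv :: w)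
        (fun y hy => by have := hu y hy; simp only [avoids_append, avoids_cons] at this; tauto)
        (fun y hy => by
          have := hu y hy
          simp only [avoids_append, avoids_cons] at this ⊢
          tauto)
      simp only [List.append_assoc, List.cons_append] at s1 s2 s3 s4 ⊢
      exact s1.trans (s2.trans (s3.trans s4))
  | refl => exact .refl _
  | symm u v h ih => exact (ih fun x hx => (WordSim.avoids_iff h).2 (hu x hx)).symm
  | trans u v w h h' ih ih' =>
    exact (ih hu).trans (ih' fun x hx => WordSim.avoids_iff h |>.1 (hu x hx))

end IsBlock

/-! ### Splitting blocks off words with two markers. -/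

/-- Every letter less than `k` occurs twice or not at all, the letters `k` and `k + 1` occur once,
and there are no other letters. -/
structure IsMarkedWord (k : ℕ) (w : List Letter) : Prop where
  lt : ∀ a < k, letterCount a w = 0 ∨ letterCount a w = 2
  fst : letterCount k w = 1
  snd : letterCount (k + 1) w = 1
  gt : ∀ a, k + 1 < a → letterCount a w = 0

lemma IsMarkedWord.of_wordSim {k : ℕ} {w w' : List Letter} (hw : IsMarkedWord k w)
    (h : WordSim k w w') : IsMarkedWord k w' := by
  have e : ∀ a, letterCount a w' = letterCount a w := fun a => (h.letterCount_eq a).symm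
  exact ⟨by simpa only [e] using hw.lt, by simpa only [e] using hw.fst,
    by simpa only [e] using hw.snd, by simpa only [e] using hw.gt⟩

/-- A crosscap, an edge with a free vertex, or a handle splits off. -/
def Splits (k : ℕ) (w : List Letter) : Prop := ∃ T w', IsBlock k T ∧ WordSim k w (T ++ w')

lemma Splits.of_wordSim {k : ℕ} {w w' : List Letter} (h : WordSim k w w') (h' : Splits k w') :
    Splits k w := by
  obtain ⟨T, v, hT, hv⟩ := h'
  exact ⟨T, v, hT, h.trans hv⟩

lemma splits_cross {k : ℕ} {x : Letter} (hx : x.1 < k) {p u v : List Letter}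
    (hp : Avoids x.1 p) (hu : Avoids x.1 u) (hv : Avoids x.1 v) :
    Splits k (p ++ x :: u ++ x :: v) := by
  have s1 := WordSim.rotate (k := k) p (x :: u ++ x :: v)
  have s2 := WordSim.cross hx (u := u) (v := v ++ p) hu (by simp [hv, hp])
  simp only [List.append_assoc, List.cons_append] at s1 s2
  refine ⟨[x, x], wordInv u ++ (v ++ p), .crosscap x hx, ?_⟩
  simp only [List.append_assoc, List.cons_append]
  exact s1.trans s2

/-- An empty segment leaves a spur. Otherwise consider the partner of the first letter y of the
segment: if it has the same direction, a crosscap splits off; if it is y⁻¹ outside the segment, the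
pairs of x and y are linked and form a handle; if it is y⁻¹ inside, it bounds a shorter unmarked
segment, whence the induction on the length. -/
lemma splits_of_unmarked_segment {k : ℕ} : ∀ (n : ℕ) (x : Letter) (p u v : List Letter),
    u.length ≤ n → x.1 < k → (∀ y ∈ u, y.1 < k) →
    IsMarkedWord k (p ++ x :: u ++ x.inv :: v) → Splits k (p ++ x :: u ++ x.inv :: v) := by
  intro n
  induction n with
  | zero =>
    intro x p u v hn hx hu hw
    obtain rfl : u = [] := List.length_eq_zero_iff.1 (by omega)
    refine ⟨_, v ++ p, .spur x hx, ?_⟩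
    have := WordSim.rotate (k := k) p (x :: x.inv :: v)
    simpa using this
  | succ n ih =>
    intro x p u v hn hx hu hw
    cases u with
    | nil =>
      refine ⟨_, v ++ p, .spur x hx, ?_⟩
      have := WordSim.rotate (k := k) p (x :: x.inv :: v)
      simpa using this
    | cons y u =>
      have hy : y.1 < k := hu y (by simp)
      have hcx := hw.lt x.1 hx
      have hcy := hw.lt y.1 hy
      simp only [letterCount_append, letterCount_cons, Letter.inv_fst, letterHit_self] at hcx hcy
      have hyx : y.1 ≠ x.1 := by
        intro h; rw [h, letterHit_self] at hcx; omega
      rw [letterHit_of_ne hyx] at hcx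
      rw [letterHit_of_ne hyx.symm] at hcy
      have ax : Avoids x.1 p ∧ Avoids x.1 u ∧ Avoids x.1 v := by
        simp only [← letterCount_eq_zero]; omega
      by_cases hyu : letterCount y.1 u = 1
      · obtain ⟨u₁, z, u₂, rfl, hz, h1, h2⟩ := exists_split hyu
        simp only [letterCount_append, letterCount_cons, hz, letterHit_self] at hcy
        have ay : Avoids y.1 p ∧ Avoids y.1 v := by
          simp only [← letterCount_eq_zero]; omega
        rcases Letter.eq_or_eq_inv hz with rfl | rfl
        · have := splits_cross hy (p := p ++ [x]) (u := u₁) (v := u₂ ++ x.inv :: v)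
            (by simp [ay, hyx.symm]) h1 (by simp [h2, ay, hyx.symm])
          simpa using this
        · have := ih y (p ++ [x]) u₁ (u₂ ++ x.inv :: v)
            (by simp only [List.length_cons, List.length_append] at hn; omega) hy
            (fun z hz => hu z (by simp [hz])) (by simpa using hw)
          simpa using this
      · have hpv : letterCount y.1 u = 0 ∧ letterCount y.1 (v ++ p) = 1 := by
          rw [letterCount_append]; omega
        obtain ⟨hu0, hvp⟩ := hpv
        obtain ⟨v₁, z, v₂, e, hz, h1, h2⟩ := exists_split hvp
        rw [letterCount_eq_zero] at hu0
        have s1 : WordSim k (p ++ x :: (y :: u) ++ x.inv :: v)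
            (x :: y :: u ++ x.inv :: (v ++ p)) := by
          simpa using WordSim.rotate (k := k) p (x :: y :: u ++ x.inv :: v)
        have ax' : Avoids x.1 (v ++ p) := by simp [ax]
        refine Splits.of_wordSim s1 ?_
        rw [e] at ax' ⊢
        simp only [avoids_append, avoids_cons] at ax'
        rcases Letter.eq_or_eq_inv hz with rfl | rfl
        · have := splits_cross hy (p := [x]) (u := u ++ x.inv :: v₁) (v := v₂)
            (by simp [hyx.symm]) (by simp [h1, hu0, hyx.symm]) h2
          simpa using this
        · refine ⟨_, v₂ ++ v₁ ++ u, .handle x y hx hy hyx.symm, ?_⟩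
          have := WordSim.handle hx hy hyx.symm (u₁ := []) (u₂ := u) (v₁ := v₁) (v₂ := v₂)
            (by simp) ax.2.1 ax'.1 ax'.2.2 (by simp) hu0 h1 h2
          simpa using this

end Spindle

namespace Spindle

open Set Topology unitInterval

/-- A word consisting of the markers, without or with an edge that separates them. -/
def IsBaseWord (k : ℕ) (w : List Letter) : Prop :=
  ∃ m m' : Letter, (m.1 = k ∧ m'.1 = k + 1 ∨ m.1 = k + 1 ∧ m'.1 = k) ∧
    (w = [m, m'] ∨ ∃ x : Letter, x.1 < k ∧ w = [x, m, x.inv, m'])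

lemma lt_of_avoids_markers {k : ℕ} {w u v : List Letter} (hw : IsMarkedWord k w)
    (e : ∀ a, letterCount a w = letterCount a u + letterCount a v) (h₁ : letterCount k u = 0)
    (h₂ : letterCount (k + 1) u = 0) : ∀ y ∈ u, y.1 < k := by
  intro y hy
  by_contra! h
  have h0 : letterCount y.1 u ≠ 0 := fun h' => letterCount_eq_zero.1 h' y hy rfl
  have h1 : y.1 ≠ k := by rintro h'; rw [h'] at h0; exact h0 h₁
  have h2 : y.1 ≠ k + 1 := by rintro h'; rw [h'] at h0; exact h0 h₂
  have := hw.gt y.1 (by omega)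
  rw [e] at this
  omega

/-- The partner of y again decides. With equal directions there is a crosscap; y⁻¹ in v links y with
x to a handle; y⁻¹ in u bounds a segment that is unmarked, because the only marker on this side of x
precedes y. -/
lemma splits_of_marker_cons {k : ℕ} {x y m m' : Letter} {u v : List Letter} (hx : x.1 < k)
    (hy : y.1 < k) (hm : k ≤ m.1) (hm' : k ≤ m'.1) (hu : ∀ z ∈ u, z.1 < k)
    (hw : IsMarkedWord k (x :: m :: y :: u ++ x.inv :: m' :: v)) :
    Splits k (x :: m :: y :: u ++ x.inv :: m' :: v) := by
  have hcx := hw.lt x.1 hx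
  have hcy := hw.lt y.1 hy
  simp only [letterCount_append, letterCount_cons, Letter.inv_fst, letterHit_self] at hcx hcy
  have hyx : y.1 ≠ x.1 := by
    intro h; rw [h, letterHit_self] at hcx; omega
  have mx : m.1 ≠ x.1 := by omega
  have mx' : m'.1 ≠ x.1 := by omega
  have my : m.1 ≠ y.1 := by omega
  have my' : m'.1 ≠ y.1 := by omega
  rw [letterHit_of_ne hyx, letterHit_of_ne mx, letterHit_of_ne mx'] at hcx
  rw [letterHit_of_ne hyx.symm, letterHit_of_ne my, letterHit_of_ne my'] at hcy
  have ax : Avoids x.1 u ∧ Avoids x.1 v := by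
    simp only [← letterCount_eq_zero]; omega
  by_cases hyu : letterCount y.1 u = 1
  · obtain ⟨u₁, z, u₂, rfl, hz, h1, h2⟩ := exists_split hyu
    simp only [letterCount_append, letterCount_cons, hz, letterHit_self] at hcy
    have ay : Avoids y.1 v := by
      simp only [← letterCount_eq_zero]; omega
    rcases Letter.eq_or_eq_inv hz with rfl | rfl
    · have := splits_cross hy (p := [x, m]) (u := u₁) (v := u₂ ++ x.inv :: m' :: v)
        (by simp [my, hyx.symm]) h1 (by simp [h2, ay, hyx.symm, my'])
      simpa using this
    · have := splits_of_unmarked_segment u₁.length y [x, m] u₁ (u₂ ++ x.inv :: m' :: v) le_rfl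
        hy (fun z hz => hu z (by simp [hz])) (by simpa using hw)
      simpa using this
  · have hpv : letterCount y.1 u = 0 ∧ letterCount y.1 v = 1 := by omega
    obtain ⟨hu0, hv1⟩ := hpv
    rw [letterCount_eq_zero] at hu0
    obtain ⟨v₁, z, v₂, rfl, hz, h1, h2⟩ := exists_split hv1
    have ax' := ax.2
    simp only [avoids_append, avoids_cons] at ax'
    rcases Letter.eq_or_eq_inv hz with rfl | rfl
    · have := splits_cross hy (p := [x, m]) (u := u ++ x.inv :: m' :: v₁) (v := v₂)
        (by simp [hyx.symm, my]) (by simp [h1, hu0, hyx.symm, my']) h2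
      simpa using this
    · refine ⟨_, v₂ ++ (m' :: v₁) ++ u ++ [m], .handle x y hx hy hyx.symm, ?_⟩
      have := WordSim.handle hx hy hyx.symm (u₁ := [m]) (u₂ := u) (v₁ := m' :: v₁) (v₂ := v₂)
        (by simp [mx]) ax.1 (by simp [mx', ax'.1]) ax'.2.2 (by simp [my]) hu0 (by simp [my', h1]) h2
      simpa using this

lemma splits_or_base_of_no_edges {k : ℕ} {w : List Letter} (hw : IsMarkedWord k w)
    (h : ∀ x ∈ w, k ≤ x.1) : ∃ w', WordSim k w w' ∧ IsBaseWord k w' := by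
  obtain ⟨u, m, v, rfl, hm, hu, hv⟩ := exists_split hw.fst
  have h2 := hw.snd
  have mk : m.1 ≠ k + 1 := by omega
  rw [letterCount_append, letterCount_cons, letterHit_of_ne mk] at h2
  obtain ⟨p, m', q, e, hm', hp, hq⟩ := exists_split (a := k + 1) (w := v ++ u)
    (by rw [letterCount_append]; omega)
  have hc : ∀ a, letterCount a p + letterCount a q + letterHit a m'.1 =
      letterCount a u + letterCount a v := by
    intro a
    have := congrArg (letterCount a) e
    simp only [letterCount_append, letterCount_cons] at this
    omega
  have hz : ∀ a, letterCount a p + letterCount a q = 0 := by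
    intro a
    have ha := hc a
    rcases lt_trichotomy a k with hak | rfl | hak
    · have : letterCount a (u ++ m :: v) = 0 :=
        letterCount_eq_zero.2 fun x hx hxa => by have := h x hx; omega
      rw [letterCount_append, letterCount_cons] at this
      omega
    · rw [letterCount_eq_zero.2 hu, letterCount_eq_zero.2 hv] at ha; omega
    · rcases eq_or_lt_of_le (Nat.succ_le_of_lt hak) with rfl | hak'
      · have := letterCount_eq_zero.2 hp
        have := letterCount_eq_zero.2 hq
        simp only [Nat.succ_eq_add_one]
        omega
      · have := hw.gt a hak'
        rw [letterCount_append, letterCount_cons] at this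
        omega
  obtain rfl : p = [] := eq_nil_of_letterCount fun a => by have := hz a; omega
  obtain rfl : q = [] := eq_nil_of_letterCount fun a => by have := hz a; omega
  refine ⟨[m, m'], ?_, m, m', Or.inl ⟨hm, hm'⟩, Or.inl rfl⟩
  have := WordSim.rotate (k := k) u (m :: v)
  rwa [List.cons_append, e] at this

/-- For a pair x, x⁻¹ of opposite edges, an arc between them without markers yields a block.
Otherwise each arc contains one marker, and slides bring the markers directly behind x and x⁻¹. Any
further letter then yields a block, and with none left the word is that of an annulus with a marker
on each boundary circle. -/
lemma splits_or_base {k : ℕ} {w : List Letter} (hw : IsMarkedWord k w) :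
    Splits k w ∨ ∃ w', WordSim k w w' ∧ IsBaseWord k w' := by
  by_cases hex : ∀ x ∈ w, k ≤ x.1
  · exact Or.inr (splits_or_base_of_no_edges hw hex)
  push Not at hex
  obtain ⟨x, hxw, hx⟩ := hex
  obtain ⟨p, t, rfl⟩ := List.append_of_mem hxw
  have hcx := hw.lt x.1 hx
  rw [letterCount_append, letterCount_cons, letterHit_self] at hcx
  obtain ⟨u, y, v, e, hy, hxu, hxv⟩ := exists_split (a := x.1) (w := t ++ p)
    (by rw [letterCount_append]; omega)
  have s0 : WordSim k (p ++ x :: t) (x :: u ++ y :: v) := by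
    have := WordSim.rotate (k := k) p (x :: t)
    rw [List.cons_append, e] at this
    simpa using this
  rcases Letter.eq_or_eq_inv hy with rfl | rfl
  · left
    exact .of_wordSim s0 (splits_cross hx (p := []) (by simp) hxu hxv)
  replace hw := hw.of_wordSim s0
  suffices h : Splits k (x :: u ++ x.inv :: v) ∨
      ∃ w', WordSim k (x :: u ++ x.inv :: v) w' ∧ IsBaseWord k w' by
    rcases h with h | ⟨w', h, h'⟩
    · exact Or.inl (.of_wordSim s0 h)
    · exact Or.inr ⟨w', s0.trans h, h'⟩
  clear s0 e
  have hk : x.1 ≠ k := by omega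
  have hk1 : x.1 ≠ k + 1 := by omega
  have c1 := hw.fst
  have c2 := hw.snd
  simp only [letterCount_append, letterCount_cons, Letter.inv_fst, letterHit_of_ne hk,
    letterHit_of_ne hk1] at c1 c2
  by_cases hu0 : letterCount k u = 0 ∧ letterCount (k + 1) u = 0
  · left
    refine splits_of_unmarked_segment u.length x [] u v le_rfl hx ?_ hw
    exact lt_of_avoids_markers hw (v := x :: x.inv :: v) (fun a => by
      simp only [letterCount_append, letterCount_cons]; omega) hu0.1 hu0.2
  by_cases hv0 : letterCount k v = 0 ∧ letterCount (k + 1) v = 0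
  · left
    have s1 : WordSim k (x :: u ++ x.inv :: v) (x.inv :: v ++ x.inv.inv :: u) := by
      simpa using WordSim.rotate (k := k) (x :: u) (x.inv :: v)
    refine .of_wordSim s1 (splits_of_unmarked_segment v.length x.inv [] v u le_rfl hx ?_
      (hw.of_wordSim s1))
    exact lt_of_avoids_markers hw (v := x :: u ++ [x.inv]) (fun a => by
      simp only [letterCount_append, letterCount_cons, letterCount_nil]; omega) hv0.1 hv0.2
  have hsplit : ∃ m m' : Letter, (m.1 = k ∧ m'.1 = k + 1 ∨ m.1 = k + 1 ∧ m'.1 = k) ∧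
      ∃ u₁ u₂ v₁ v₂, u = u₁ ++ m :: u₂ ∧ v = v₁ ++ m' :: v₂ := by
    by_cases h : letterCount k u = 1
    · obtain ⟨u₁, m, u₂, e, hm, -⟩ := exists_split h
      obtain ⟨v₁, m', v₂, e', hm', -⟩ := exists_split (a := k + 1) (w := v) (by omega)
      exact ⟨m, m', Or.inl ⟨hm, hm'⟩, u₁, u₂, v₁, v₂, e, e'⟩
    · obtain ⟨u₁, m, u₂, e, hm, -⟩ := exists_split (a := k + 1) (w := u) (by omega)
      obtain ⟨v₁, m', v₂, e', hm', -⟩ := exists_split (a := k) (w := v) (by omega)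
      exact ⟨m, m', Or.inr ⟨hm, hm'⟩, u₁, u₂, v₁, v₂, e, e'⟩
  obtain ⟨m, m', hmm, u₁, u₂, v₁, v₂, rfl, rfl⟩ := hsplit
  simp only [avoids_append, avoids_cons] at hxu hxv
  obtain ⟨a1, a2, a3⟩ := hxu
  obtain ⟨b1, b2, b3⟩ := hxv
  have s1 : WordSim k (x :: (u₁ ++ m :: u₂) ++ x.inv :: (v₁ ++ m' :: v₂))
      (x :: m :: (u₂ ++ u₁) ++ x.inv :: m' :: (v₂ ++ v₁)) := by
    have r1 := WordSim.slide_inside hx (u := u₁) (v := m :: u₂) (w := v₁ ++ m' :: v₂) a1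
      (by simp [a2, a3]) (by simp [b1, b2, b3])
    have r2 := WordSim.slide hx (u := m :: u₂ ++ u₁) (v := v₁) (w := m' :: v₂)
      (by simp [a1, a2, a3]) b1 (by simp [b2, b3])
    simp only [List.append_assoc, List.cons_append] at r1 r2 ⊢
    exact r1.trans r2
  replace hw := hw.of_wordSim s1
  suffices h : ∀ u v, IsMarkedWord k (x :: m :: u ++ x.inv :: m' :: v) →
      Splits k (x :: m :: u ++ x.inv :: m' :: v) ∨
      ∃ w', WordSim k (x :: m :: u ++ x.inv :: m' :: v) w' ∧ IsBaseWord k w' by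
    rcases h _ _ hw with h | ⟨w', h, h'⟩
    · exact Or.inl (.of_wordSim s1 h)
    · exact Or.inr ⟨w', s1.trans h, h'⟩
  clear hw s1 c1 c2 hu0 hv0 a1 a3 b1 b3 u₁ u₂ v₁ v₂
  intro u v hw
  have hlt : (∀ y ∈ u, y.1 < k) ∧ ∀ y ∈ v, y.1 < k := by
    have c1 := hw.fst
    have c2 := hw.snd
    simp only [letterCount_append, letterCount_cons, Letter.inv_fst, letterHit_of_ne hk,
      letterHit_of_ne hk1] at c1 c2
    have hmm1 : letterHit k m.1 + letterHit k m'.1 = 1 := by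
      rcases hmm with ⟨h, h'⟩ | ⟨h, h'⟩ <;> simp [h, h', letterHit]
    have hmm2 : letterHit (k + 1) m.1 + letterHit (k + 1) m'.1 = 1 := by
      rcases hmm with ⟨h, h'⟩ | ⟨h, h'⟩ <;> simp [h, h', letterHit]
    constructor
    · exact lt_of_avoids_markers hw (v := x :: m :: x.inv :: m' :: v) (fun a => by
        simp only [letterCount_append, letterCount_cons]; omega) (by omega) (by omega)
    · exact lt_of_avoids_markers hw (v := x :: m :: u ++ [x.inv, m']) (fun a => by
        simp only [letterCount_append, letterCount_cons, letterCount_nil]; omega)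
        (by omega) (by omega)
  cases u with
  | cons y u =>
    exact Or.inl (splits_of_marker_cons hx (hlt.1 y (by simp)) (by omega) (by omega)
      (fun z hz => hlt.1 z (by simp [hz])) hw)
  | nil =>
    cases v with
    | nil => exact Or.inr ⟨_, .refl _, m, m', hmm, Or.inr ⟨x, hx, rfl⟩⟩
    | cons y v =>
      left
      have s1 : WordSim k (x :: m :: [] ++ x.inv :: m' :: y :: v)
          (x.inv :: m' :: y :: v ++ x.inv.inv :: m :: []) := by
        simpa using WordSim.rotate (k := k) [x, m] (x.inv :: m' :: y :: v)
      exact .of_wordSim s1 (splits_of_marker_cons (x := x.inv) hx (hlt.2 y (by simp)) (by omega)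
        (by omega) (fun z hz => hlt.2 z (by simp [hz])) (hw.of_wordSim s1))

/-! ### Interchanging the markers. -/

/-- Interchange of the markers `k` and `k + 1`, with inversion if `η = -1`. -/
def markerSwap (k : ℕ) (η : ℤˣ) (x : Letter) : Letter :=
  if x.1 = k then (k + 1, η * x.2) else if x.1 = k + 1 then (k, η * x.2) else x

lemma markerSwap_of_lt {k : ℕ} (η : ℤˣ) {x : Letter} (h : x.1 < k) : markerSwap k η x = x := by
  rw [markerSwap, if_neg (by omega), if_neg (by omega)]

lemma markerSwap_inv (k : ℕ) (η : ℤˣ) (x : Letter) :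
    markerSwap k η x.inv = (markerSwap k η x).inv := by
  obtain ⟨a, δ⟩ := x
  by_cases h : a = k
  · simp [markerSwap, Letter.inv, h]
  · by_cases h' : a = k + 1 <;> simp [markerSwap, Letter.inv, h, h']

lemma le_markerSwap {k : ℕ} (η : ℤˣ) {x : Letter} (h : k ≤ x.1) : k ≤ (markerSwap k η x).1 := by
  unfold markerSwap
  split_ifs <;> simp [h]

lemma WordSim.markerSwap {k : ℕ} (η : ℤˣ) {u v : List Letter} (h : WordSim k u v) :
    WordSim k (u.map (markerSwap k η)) (v.map (markerSwap k η)) := by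
  have := h.flatMap (f := fun x => [Spindle.markerSwap k η x])
    (fun x => by simp [markerSwap_inv]) (fun x hx => by rw [markerSwap_of_lt η hx])
    (fun x hx a ha => by have := le_markerSwap η hx; simp; omega)
  simpa only [List.flatMap_singleton', ← List.map_eq_flatMap] using this

/-- The product of `η` with the two signs decides between a direct interchange and one with
reversal. -/
lemma markerSwap_eq_or {k : ℕ} (η : ℤˣ) {m m' : Letter}
    (h : m.1 = k ∧ m'.1 = k + 1 ∨ m.1 = k + 1 ∧ m'.1 = k) :
    (markerSwap k η m = m' ∧ markerSwap k η m' = m) ∨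
      (markerSwap k η m = m'.inv ∧ markerSwap k η m' = m.inv) := by
  obtain ⟨a, δ⟩ := m
  obtain ⟨b, ε⟩ := m'
  rcases Int.units_eq_one_or η with rfl | rfl <;> rcases Int.units_eq_one_or δ with rfl | rfl <;>
    rcases Int.units_eq_one_or ε with rfl | rfl <;> rcases h with ⟨rfl, rfl⟩ | ⟨rfl, rfl⟩ <;>
    simp [markerSwap, Letter.inv]

/-- Rotation gives the direct interchange and reflection the one with reversal. For the annulus, a
flip of x restores the direction of the connecting edge. -/
lemma IsBaseWord.wordSim_markerSwap {k : ℕ} (η : ℤˣ) {w : List Letter} (hw : IsBaseWord k w) :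
    WordSim k w (w.map (markerSwap k η)) := by
  obtain ⟨m, m', h, hw⟩ := hw
  rcases hw with rfl | ⟨x, hx, rfl⟩
  · rcases markerSwap_eq_or η h with ⟨e, e'⟩ | ⟨e, e'⟩
    · simpa [e, e'] using WordSim.rotate (k := k) [m] [m']
    · simpa [e, e'] using WordSim.invert (k := k) [m, m']
  · have hx' : markerSwap k η x = x := markerSwap_of_lt η hx
    have hx'' : markerSwap k η x.inv = x.inv := markerSwap_of_lt η hx
    have f1 : flipLetter x.1 x.inv = x := by simp [flipLetter]
    have f2 : flipLetter x.1 x = x.inv := by simp [flipLetter]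
    have f3 : ∀ z : Letter, k ≤ z.1 → flipLetter x.1 z = z := fun z hz => by
      rw [flipLetter, if_neg (by omega)]
    have g : k ≤ m.1 ∧ k ≤ m'.1 := by omega
    rcases markerSwap_eq_or η h with ⟨e, e'⟩ | ⟨e, e'⟩
    · have s1 := WordSim.rotate (k := k) [x, m] [x.inv, m']
      have s2 := WordSim.flip hx [x.inv, m', x, m]
      simp only [List.map_cons, List.map_nil, f1, f2, f3 _ g.1, f3 _ g.2, e, e', hx', hx'',
        List.cons_append, List.nil_append] at s1 s2 ⊢
      exact s1.trans s2
    · have s1 := WordSim.invert (k := k) [x, m, x.inv, m']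
      have s2 := WordSim.rotate (k := k) [m'.inv, x, m.inv] [x.inv]
      have s3 := WordSim.flip hx [x.inv, m'.inv, x, m.inv]
      have g1 := f3 m.inv g.1
      have g2 := f3 m'.inv g.2
      simp only [List.map_cons, List.map_nil, f1, f2, g1, g2, e, e', hx', hx'', wordInv_cons,
        wordInv_nil, Letter.inv_inv, List.cons_append, List.nil_append] at s1 s2 s3 ⊢
      exact s1.trans (s2.trans s3)

/-- A block contains both occurrences of each of its letters and no marker. -/
lemma IsMarkedWord.of_append {k : ℕ} {T w : List Letter} (hT : IsBlock k T)
    (h : IsMarkedWord k (T ++ w)) : IsMarkedWord k w ∧ ∀ x ∈ T, Avoids x.1 w := by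
  have hlt := h.lt
  have h1 := h.fst
  have h2 := h.snd
  have hgt := h.gt
  simp only [letterCount_append] at hlt h1 h2 hgt
  have tge : ∀ a, k ≤ a → Spindle.letterCount a T = 0 := fun a ha =>
    letterCount_eq_zero.2 fun x hx h => by have := hT.lt x hx; omega
  refine ⟨⟨fun a ha => ?_, ?_, ?_, fun a ha => ?_⟩, fun x hx => ?_⟩
  · have := hlt a ha
    have := hT.letterCount a
    omega
  · rwa [tge k le_rfl, zero_add] at h1
  · rwa [tge (k + 1) (by omega), zero_add] at h2
  · have := hgt a ha
    omega
  · have h3 : Spindle.letterCount x.1 T ≠ 0 := fun h' => letterCount_eq_zero.1 h' x hx rfl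
    have := hT.letterCount x.1
    have := hlt x.1 (hT.lt x hx)
    exact letterCount_eq_zero.1 (by omega)

/-- A marked word can be transformed into the word with interchanged markers. -/
theorem IsMarkedWord.wordSim_markerSwap {k : ℕ} (η : ℤˣ) : ∀ (n : ℕ) (w : List Letter),
    w.length ≤ n → IsMarkedWord k w → WordSim k w (w.map (markerSwap k η)) := by
  intro n
  induction n with
  | zero =>
    intro w hn hw
    obtain rfl : w = [] := List.length_eq_zero_iff.1 (by omega)
    exact .refl _
  | succ n ih =>
    intro w hn hw
    rcases splits_or_base hw with ⟨T, w', hT, h⟩ | ⟨w', h, hb⟩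
    · obtain ⟨hw', hTw⟩ := (hw.of_wordSim h).of_append hT
      have hl := h.length_eq
      have := hT.length_pos
      rw [List.length_append] at hl
      -- The interchange is performed on the shorter word `w'`. As `T` contains no marker, the
      -- result is the interchange applied to `T ++ w'`, and the splitting is then undone for the
      -- interchanged markers.
      have s1 := hT.append_congr (ih w' (by omega) hw') hTw
      have e : T.map (Spindle.markerSwap k η) = T := by
        conv_rhs => rw [← List.map_id T]
        exact List.map_congr_left fun x hx => markerSwap_of_lt η (hT.lt x hx)
      have s2 := h.markerSwap η
      rw [List.map_append, e] at s2
      exact h.trans (s1.trans s2.symm)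
    · exact h.trans ((hb.wordSim_markerSwap η).trans (h.markerSwap η).symm)

/-- The substitution of words for the markers. -/
def substMarkers (k : ℕ) (y z : List Letter) (x : Letter) : List Letter :=
  if x.1 < k then [x]
  else if x.1 = k then (if x.2 = 1 then y else wordInv y)
  else (if x.2 = 1 then z else wordInv z)

lemma substMarkers_inv (k : ℕ) (y z : List Letter) (x : Letter) :
    substMarkers k y z x.inv = wordInv (substMarkers k y z x) := by
  have h : (-1 : ℤˣ) ≠ 1 := by decide
  obtain ⟨a, δ⟩ := x
  by_cases h₁ : a < k
  · simp [substMarkers, Letter.inv, h₁]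
  · by_cases h₂ : a = k <;> rcases Int.units_eq_one_or δ with rfl | rfl <;>
      simp [substMarkers, Letter.inv, h₁, h₂, h]

lemma flatMap_substMarkers_of_lt {k : ℕ} (y z : List Letter) {w : List Letter}
    (hw : ∀ x ∈ w, x.1 < k) : w.flatMap (substMarkers k y z) = w := by
  induction w with
  | nil => rfl
  | cons x w ih =>
    rw [List.flatMap_cons, ih fun x hx => hw x (by simp [hx]), substMarkers,
      if_pos (hw x (by simp))]
    rfl

/-- Two segments of a boundary word that have no letters in common with its remaining segments can
be interchanged, and they can be inverted. -/
theorem wordEquiv_of_segments {k : ℕ} {A C y z : List Letter} (hlt : ∀ x ∈ A ++ C, x.1 < k)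
    (hAC : ∀ a, letterCount a (A ++ C) = 0 ∨ letterCount a (A ++ C) = 2)
    (hy : ∀ x ∈ y, k ≤ x.1) (hz : ∀ x ∈ z, k ≤ x.1) :
    WordEquiv (A ++ y ++ C ++ z) (C ++ y ++ A ++ z) ∧
      WordEquiv (A ++ y ++ C ++ z) (wordInv A ++ y ++ wordInv C ++ z) := by
  have hA : ∀ x ∈ A, x.1 < k := fun x hx => hlt x (by simp [hx])
  have hC : ∀ x ∈ C, x.1 < k := fun x hx => hlt x (by simp [hx])
  have hge : ∀ a, k ≤ a → letterCount a A = 0 ∧ letterCount a C = 0 := fun a ha =>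
    ⟨letterCount_eq_zero.2 fun x hx h => by have := hA x hx; omega,
      letterCount_eq_zero.2 fun x hx h => by have := hC x hx; omega⟩
  -- Here k and k + 1 only stand for y and z. They may also occur as letters of y or z, since the
  -- substitution is made once and simultaneously.
  have hw : IsMarkedWord k (A ++ [(k, 1)] ++ C ++ [(k + 1, 1)]) := by
    refine ⟨fun a ha => ?_, ?_, ?_, fun a ha => ?_⟩
    · have := hAC a
      rw [letterCount_append] at this
      simp only [letterCount_append, letterCount_cons, letterCount_nil,
        letterHit_of_ne (show k ≠ a by omega), letterHit_of_ne (show k + 1 ≠ a by omega)]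
      omega
    · have := hge k le_rfl
      simp [this, letterHit]
    · have := hge (k + 1) (by omega)
      simp [this, letterHit]
    · have := hge a (by omega)
      simp only [letterCount_append, letterCount_cons, letterCount_nil, this,
        letterHit_of_ne (show k ≠ a by omega), letterHit_of_ne (show k + 1 ≠ a by omega)]
  have key : ∀ η : ℤˣ, WordEquiv (A ++ y ++ C ++ z)
      (A ++ (if η = 1 then z else wordInv z) ++ C ++ (if η = 1 then y else wordInv y)) := by
    intro η
    have s := IsMarkedWord.wordSim_markerSwap η _ _ le_rfl hw
    have s' := (s.flatMap (substMarkers_inv k y z) (fun x hx => if_pos hx) (fun x hx a ha => by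
      have ay : Avoids a y := fun x hx => by have := hy x hx; omega
      have az : Avoids a z := fun x hx => by have := hz x hx; omega
      unfold substMarkers
      rw [if_neg (by omega)]
      split_ifs <;> simp [ay, az])).wordEquiv
    have mA : A.map (markerSwap k η) = A := by
      conv_rhs => rw [← List.map_id A]
      exact List.map_congr_left fun x hx => markerSwap_of_lt η (hA x hx)
    have mC : C.map (markerSwap k η) = C := by
      conv_rhs => rw [← List.map_id C]
      exact List.map_congr_left fun x hx => markerSwap_of_lt η (hC x hx)
    simp only [List.map_append, mA, mC, List.flatMap_append, flatMap_substMarkers_of_lt y z hA,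
      flatMap_substMarkers_of_lt y z hC] at s'
    simpa [markerSwap, substMarkers] using s'
  have r : ∀ u v : List Letter, WordEquiv (u ++ v) (v ++ u) := fun u v =>
    (polygonIso_rotate u v).wordEquiv
  -- With η = 1, A z C y is rotated to C y A z. With η = -1, A z⁻¹ C y⁻¹ is inverted to y C⁻¹ z A⁻¹
  -- and rotated to A⁻¹ y C⁻¹ z.
  constructor
  · have s1 := key 1
    have s2 := r (A ++ z) (C ++ y)
    simp only [if_true, List.append_assoc] at s1 s2 ⊢
    exact s1.trans s2
  · have s1 := key (-1)
    have s2 := (polygonIso_wordInv (A ++ wordInv z ++ C ++ wordInv y)).wordEquiv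
    have s3 := r (y ++ wordInv C ++ z) (wordInv A)
    simp only [show (-1 : ℤˣ) ≠ 1 by decide, if_false, List.append_assoc, wordInv_append,
      wordInv_wordInv] at s1 s2 s3 ⊢
    exact s1.trans (s2.trans s3)

end Spindle

namespace Spindle

open Set Topology

/-! ### Gluing a pair of polygons to one polygon. -/

/-- The surface of a pair of polygons with boundary words `u` and `v` is homeomorphic to that of
one polygon with boundary word `w`, with vertices corresponding to vertices. -/
def PairToWord (u v w : List Letter) : Prop :=
  MarkedHomeo (LabelRel (HasLabel₂ u v)) (corners₂ u.length v.length)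
    (LabelRel (HasLabel w)) (corners w.length)

/-- Rotate to B A b and b⁻¹ B₁ C B₀ and glue along b. Nonempty A and C ensure that each polygon
keeps an edge besides b. -/
lemma pairToWord_of_inv {A C B B₀ B₁ : List Letter} {b : Letter} (hA : Avoids b.1 A)
    (hC : Avoids b.1 C) (hB : Avoids b.1 B) (hB₀ : Avoids b.1 B₀) (hB₁ : Avoids b.1 B₁)
    (hA' : A ≠ []) (hC' : C ≠ []) :
    PairToWord (A ++ b :: B) (C ++ (B₀ ++ b.inv :: B₁)) (A ++ B₁ ++ C ++ (B₀ ++ B)) := by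
  have s1 : PairEquiv (A ++ b :: B) (C ++ (B₀ ++ b.inv :: B₁)) ((B ++ A) ++ [b])
      (b.inv :: (B₁ ++ C ++ B₀)) := by
    refine PolygonIso.pairEquiv ?_ ?_
    · simpa using polygonIso_rotate (A ++ [b]) B
    · simpa using polygonIso_rotate (C ++ B₀) (b.inv :: B₁)
  have s2 := merge_markedHomeo (u := B ++ A) (v := B₁ ++ C ++ B₀) (c := b) (by simp [hA'])
    (by simp [hC']) (by simp [hA, hB]) (by simp [hC, hB₀, hB₁])
  have s3 : WordEquiv ((B ++ A) ++ (B₁ ++ C ++ B₀)) (A ++ B₁ ++ C ++ (B₀ ++ B)) := by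
    simpa using (polygonIso_rotate B (A ++ (B₁ ++ C ++ B₀))).wordEquiv
  exact s1.trans (s2.trans s3)

/-- When b has the same direction in both words, the second polygon is turned over first, which
inverts C. -/
lemma pairToWord_of_self {A C B B₀ B₁ : List Letter} {b : Letter} (hA : Avoids b.1 A)
    (hC : Avoids b.1 C) (hB : Avoids b.1 B) (hB₀ : Avoids b.1 B₀) (hB₁ : Avoids b.1 B₁)
    (hA' : A ≠ []) (hC' : C ≠ []) :
    PairToWord (A ++ b :: B) (C ++ (B₀ ++ b :: B₁))
      (A ++ wordInv B₀ ++ wordInv C ++ (wordInv B₁ ++ B)) := by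
  have s1 : PairEquiv (A ++ b :: B) (C ++ (B₀ ++ b :: B₁)) (A ++ b :: B)
      (wordInv C ++ (wordInv B₁ ++ b.inv :: wordInv B₀)) := by
    refine PolygonIso.pairEquiv (PolygonIso.refl _) ?_
    have h1 := polygonIso_wordInv (C ++ (B₀ ++ b :: B₁))
    have h2 := polygonIso_rotate (wordInv B₁ ++ b.inv :: wordInv B₀) (wordInv C)
    simp only [wordInv_append, wordInv_cons, List.append_assoc, List.cons_append,
      List.nil_append] at h1 h2 ⊢
    exact h1.trans h2
  have hC'' : wordInv C ≠ [] := fun h => hC' (by rw [← wordInv_wordInv C, h]; rfl)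
  exact s1.trans (pairToWord_of_inv hA (by simpa using hC) hB (by simpa using hB₁)
    (by simpa using hB₀) hA' hC'')

/-- The effect of the vertical and horizontal reflections of a block on the boundary words of the
two polygons. -/
theorem pairEquiv_block {k : ℕ} {A B C D : List Letter} {b : Letter}
    (hA : ∀ x ∈ A, x.1 < k) (hC : ∀ x ∈ C, x.1 < k) (hb : k ≤ b.1) (hB : ∀ x ∈ B, k ≤ x.1)
    (hD : ∀ x ∈ D, k ≤ x.1)
    (hAC : ∀ a, letterCount a A + letterCount a C = 0 ∨ letterCount a A + letterCount a C = 2)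
    (hA' : A ≠ []) (hC' : C ≠ []) (hbB : letterCount b.1 B = 0) (hbD : letterCount b.1 D = 1) :
    PairEquiv (A ++ b :: B) (C ++ D) (wordInv A ++ b :: B) (wordInv C ++ D) ∧
      PairEquiv (A ++ b :: B) (C ++ D) (C ++ b :: B) (A ++ D) := by
  have bA : Avoids b.1 A := fun x hx => by have := hA x hx; omega
  have bC : Avoids b.1 C := fun x hx => by have := hC x hx; omega
  have bB := letterCount_eq_zero.1 hbB
  obtain ⟨D₀, y, D₁, rfl, hy, h₀, h₁⟩ := exists_split hbD
  have bA' : Avoids b.1 (wordInv A) := by simpa using bA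
  have bC' : Avoids b.1 (wordInv C) := by simpa using bC
  have inv_ne : ∀ {w : List Letter}, w ≠ [] → wordInv w ≠ [] := fun {w} hw h =>
    hw (by rw [← wordInv_wordInv w, h]; rfl)
  have inv_mem : ∀ {w : List Letter} {P : ℕ → Prop}, (∀ x ∈ w, P x.1) →
      ∀ x ∈ wordInv w, P x.1 := fun {w P} h x hx => h x.inv (mem_wordInv.1 hx)
  have app_mem : ∀ {u v : List Letter} {P : ℕ → Prop}, (∀ x ∈ u, P x.1) → (∀ x ∈ v, P x.1) →
      ∀ x ∈ u ++ v, P x.1 := fun {u v P} h h' x hx =>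
    (List.mem_append.1 hx).elim (h x) (h' x)
  have hD₀ : ∀ x ∈ D₀, k ≤ x.1 := fun x hx => hD x (by simp [hx])
  have hD₁ : ∀ x ∈ D₁, k ≤ x.1 := fun x hx => hD x (by simp [hx])
  rcases Letter.eq_or_eq_inv hy with rfl | rfl
  -- The merged word is A y C⁻¹ z. Inverting its outer segments corresponds to (A⁻¹, C⁻¹). The pair
  -- (C, A) corresponds to C y A⁻¹ z, so the interchange must be followed by an inversion, which is
  -- `hyz'`.
  · have hyz := wordEquiv_of_segments (A := A) (C := wordInv C) (y := wordInv D₀)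
      (z := wordInv D₁ ++ B) (app_mem (P := (· < k)) hA (inv_mem (P := (· < k)) hC))
      (fun a => by simpa using hAC a) (inv_mem (P := (k ≤ ·)) hD₀)
      (app_mem (P := (k ≤ ·)) (inv_mem (P := (k ≤ ·)) hD₁) hB)
    have hyz' := wordEquiv_of_segments (A := wordInv C) (C := A) (y := wordInv D₀)
      (z := wordInv D₁ ++ B) (app_mem (P := (· < k)) (inv_mem (P := (· < k)) hC) hA)
      (fun a => by simpa [add_comm] using hAC a) (inv_mem (P := (k ≤ ·)) hD₀)
      (app_mem (P := (k ≤ ·)) (inv_mem (P := (k ≤ ·)) hD₁) hB)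
    rw [wordInv_wordInv] at hyz hyz'
    have s := pairToWord_of_self bA bC bB h₀ h₁ hA' hC'
    constructor
    · have s' := pairToWord_of_self bA' bC' bB h₀ h₁ (inv_ne hA') (inv_ne hC')
      rw [wordInv_wordInv] at s'
      exact s.trans (hyz.2.trans s'.symm)
    · have s' := pairToWord_of_self bC bA bB h₀ h₁ hC' hA'
      exact s.trans (hyz.1.trans (hyz'.2.trans s'.symm))
  · have hyz := wordEquiv_of_segments (A := A) (C := C) (y := D₁) (z := D₀ ++ B)
      (app_mem (P := (· < k)) hA hC) (fun a => by simpa using hAC a) hD₁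
      (app_mem (P := (k ≤ ·)) hD₀ hB)
    have s := pairToWord_of_inv bA bC bB h₀ h₁ hA' hC'
    constructor
    · exact s.trans (hyz.2.trans
        (pairToWord_of_inv bA' bC' bB h₀ h₁ (inv_ne hA') (inv_ne hC')).symm)
    · exact s.trans (hyz.1.trans (pairToWord_of_inv bC bA bB h₀ h₁ hC' hA').symm)

/-! ### The surface of a signed permutation in terms of words. -/

variable {n : ℕ}

def SignedIndex.toLetter (p : SignedIndex n) : Letter := (p.1.val, p.2)

lemma SignedIndex.toLetter_injective :
    Function.Injective (SignedIndex.toLetter : SignedIndex n → Letter) := by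
  intro p q h
  simp only [toLetter, Prod.mk.injEq] at h
  exact Prod.ext (Fin.ext h.1) h.2

lemma SignedIndex.toLetter_opp (p : SignedIndex n) : p.opp.toLetter = p.toLetter.inv := rfl

/-- The boundary word of the polygon `P`. -/
def sourceWord (n : ℕ) : List Letter :=
  List.ofFn fun i : Fin n => SignedIndex.toLetter (i, (1 : ℤˣ))

/-- The boundary word of the polygon `P'`. -/
def targetWord (σ : SignedPerm n) : List Letter :=
  List.ofFn fun j : Fin n => (σ.toPerm.symm (j, 1)).toLetter

lemma length_sourceWord : (sourceWord n).length = n := by simp [sourceWord]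

lemma length_targetWord (σ : SignedPerm n) : (targetWord σ).length = n := by simp [targetWord]

lemma SignedPerm.apply_units_mul (σ : SignedPerm n) (ε : ℤˣ) (p : SignedIndex n) :
    σ.toPerm (p.1, ε * p.2) = ((σ.toPerm p).1, ε * (σ.toPerm p).2) := by
  rcases Int.units_eq_one_or ε with rfl | rfl
  · simp
  · simpa [SignedIndex.opp] using σ.map_opp p

lemma SignedPerm.symm_opp (σ : SignedPerm n) (p : SignedIndex n) :
    σ.toPerm.symm p.opp = (σ.toPerm.symm p).opp := by
  rw [Equiv.symm_apply_eq, σ.map_opp, Equiv.apply_symm_apply]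

lemma orientedEdge_eq_edgePoint (p : SignedIndex n) (s : unitInterval) :
    orientedEdge p s = edgePoint n p.1 p.2 s := by
  simp only [orientedEdge, edge, edgePoint, boundaryPoint, signParam, mul_div_assoc]

lemma edge_zero_eq (i : Fin n) : edge i 0 = boundaryPoint (i / n) := by
  simp [edge, boundaryPoint, mul_div_assoc]

/-- The vertices of the polygons `P` and `P'`. -/
def vertexSet (n : ℕ) : Set (Polygon ⊕ Polygon) :=
  Set.range (fun i : Fin n => Sum.inl (edge i 0)) ∪
    Set.range (fun i : Fin n => Sum.inr (mirror (edge i 0)))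

lemma zeroCells_eq (σ : SignedPerm n) : zeroCells σ = Quot.mk (Glue σ) '' vertexSet n := by
  rw [vertexSet, Set.image_union, ← Set.range_comp, ← Set.range_comp]
  rfl

lemma corners_eq_range : corners n = Set.range fun i : Fin n => edge i 0 := by
  ext z
  simp only [corners, Set.mem_ofPred_eq, Set.mem_range, edge_zero_eq]
  constructor
  · rintro ⟨i, hi, rfl⟩
    exact ⟨⟨i, hi⟩, rfl⟩
  · rintro ⟨i, rfl⟩
    exact ⟨i, i.2, rfl⟩

/-- The surface `Σ(σ)` is glued from two polygons according to their boundary words. -/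
lemma surface_markedHomeo (σ : SignedPerm n) :
    MarkedHomeo (Glue σ) (vertexSet n)
      (LabelRel (HasLabel₂ (sourceWord n) (targetWord σ)))
      (corners₂ (sourceWord n).length (targetWord σ).length) := by
  -- Every labelled point is identified in Σ(σ) with a point of `P` determined by the label alone,
  -- so equal labels give equal points.
  have lab : ∀ (z : Polygon ⊕ Polygon) (x : Letter) (s : unitInterval),
      HasLabel₂ (sourceWord n) (targetWord σ) ((Homeomorph.refl _).sumCongr mirrorHomeo z) x s →
      ∃ ha : x.1 < n, Quot.mk (Glue σ) z =
        Quot.mk _ (Sum.inl (orientedEdge ((⟨x.1, ha⟩, x.2) : SignedIndex n) s)) := by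
    rintro (z | z) ⟨a, γ⟩ s ⟨i, ε, hi, hz⟩
    · change z = _ at hz
      have hin := (List.getElem?_eq_some_iff.1 hi).1
      rw [length_sourceWord] at hin hz
      simp only [sourceWord, List.getElem?_ofFn, hin, dite_true, Option.some.injEq,
        SignedIndex.toLetter, Prod.mk.injEq] at hi
      obtain ⟨rfl, h1⟩ := hi
      obtain rfl : ε = γ := by
        have := congrArg (ε * ·) h1
        simpa [← mul_assoc, Int.units_mul_self] using this
      exact ⟨hin, by rw [hz, orientedEdge_eq_edgePoint]⟩
    · change mirror z = _ at hz
      have hin := (List.getElem?_eq_some_iff.1 hi).1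
      rw [length_targetWord] at hin hz
      simp only [targetWord, List.getElem?_ofFn, hin, dite_true, Option.some.injEq] at hi
      set q := σ.toPerm.symm (⟨i, hin⟩, 1) with hq
      have hσq : σ.toPerm q = (⟨i, hin⟩, 1) := by rw [hq, Equiv.apply_symm_apply]
      have hq1 : q.1.val = a := congrArg Prod.fst hi
      have hq2 : q.2 = ε * γ := congrArg Prod.snd hi
      subst hq1
      refine ⟨q.1.2, ?_⟩
      obtain rfl : z = mirror (edgePoint n i ε s) := by rw [← hz, mirror_mirror]
      have hσ1 : σ.toPerm (q.1, 1) = (⟨i, hin⟩, q.2) := by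
        have := σ.apply_units_mul q.2 q
        rwa [Int.units_mul_self, hσq, mul_one] at this
      have key := Quot.sound (Glue.glue (σ := σ) q.1 (signParam γ s))
      rw [hσ1, orientedEdge_eq_edgePoint, orientedEdge_eq_edgePoint] at key
      have e1 : edgePoint n q.1 1 (signParam γ s) = edgePoint n q.1 γ s := by
        simp [edgePoint]
      have e2 : edgePoint n i q.2 (signParam γ s) = edgePoint n i ε s := by
        rw [hq2]
        rcases Int.units_eq_one_or ε with rfl | rfl <;>
          rcases Int.units_eq_one_or γ with rfl | rfl <;> simp [edgePoint]
      simp only at key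
      rw [e1, e2] at key
      rw [orientedEdge_eq_edgePoint]
      exact key.symm
  refine .of_isQuotientMap (f := (Homeomorph.refl _).sumCongr mirrorHomeo)
    (Homeomorph.isQuotientMap _) ?_ ?_ ?_ ?_
  · rintro _ _ ⟨i, s⟩
    refine Quot.sound ⟨(i.val, 1), s, ⟨i, 1, ?_, ?_⟩,
      ⟨(σ.toPerm (i, 1)).1, (σ.toPerm (i, 1)).2, ?_, ?_⟩⟩
    · simp [sourceWord, SignedIndex.toLetter]
    · change orientedEdge _ _ = _
      rw [orientedEdge_eq_edgePoint, length_sourceWord]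
    · have h := σ.apply_units_mul (σ.toPerm (i, 1)).2 (i, 1)
      simp only [Int.units_mul_self] at h
      simp [targetWord, ← h, SignedIndex.toLetter]
    · change mirror (mirror _) = _
      rw [mirror_mirror, orientedEdge_eq_edgePoint, length_targetWord]
  · intro z z' h
    rw [Homeomorph.injective _ h]
  · rintro z z' ⟨x, s, h, h'⟩
    obtain ⟨ha, h⟩ := lab _ _ _ h
    obtain ⟨ha', h'⟩ := lab _ _ _ h'
    rw [h, h']
  · rw [vertexSet, Set.image_union, ← Set.range_comp, ← Set.range_comp, corners₂,
      length_sourceWord, length_targetWord, corners_eq_range, ← Set.range_comp, ← Set.range_comp]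
    congr 2
    funext i
    change Sum.inr (mirror (mirror _)) = _
    rw [mirror_mirror]
    rfl

/-- A transformation of signed indices, as a transformation of letters. -/
def extendToLetters (π : SignedIndex n → SignedIndex n) (x : Letter) : Letter :=
  if h : x.1 < n then (π (⟨x.1, h⟩, x.2)).toLetter else x

lemma extendToLetters_toLetter (π : SignedIndex n → SignedIndex n) (p : SignedIndex n) :
    extendToLetters π p.toLetter = (π p).toLetter := by
  rw [extendToLetters, dif_pos (show p.toLetter.1 < n from p.1.2)]
  rfl

lemma pairEquiv_relabel_signedIndex {π : SignedIndex n → SignedIndex n}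
    (hinj : Function.Injective π) (hopp : ∀ p, π p.opp = (π p).opp) {f g : Fin n → SignedIndex n} :
    PairEquiv (List.ofFn fun i => (f i).toLetter) (List.ofFn fun i => (g i).toLetter)
      (List.ofFn fun i => (π (f i)).toLetter) (List.ofFn fun i => (π (g i)).toLetter) := by
  have key : ∀ f : Fin n → SignedIndex n, (List.ofFn fun i => (f i).toLetter).map
      (extendToLetters π) = List.ofFn fun i => (π (f i)).toLetter := by
    intro f
    rw [List.map_ofFn]
    congr 1
    funext i
    exact extendToLetters_toLetter π (f i)
  rw [← key f, ← key g]
  refine pairEquiv_relabel ?_ ?_ _ _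
  · intro x y h
    unfold extendToLetters at h
    split_ifs at h with hx hy hy
    · have := hinj (SignedIndex.toLetter_injective h)
      simp only [Prod.mk.injEq, Fin.mk.injEq] at this
      exact Prod.ext this.1 this.2
    · exact absurd (h ▸ (π (⟨x.1, hx⟩, x.2)).1.2 : y.1 < n) hy
    · exact absurd (h ▸ (π (⟨y.1, hy⟩, y.2)).1.2 : x.1 < n) hx
    · exact h
  · intro x
    by_cases hx : x.1 < n
    · rw [extendToLetters, extendToLetters, dif_pos hx, dif_pos (show x.inv.1 < n from hx),
        ← SignedIndex.toLetter_opp, ← hopp]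
      rfl
    · rw [extendToLetters, extendToLetters, dif_neg hx, dif_neg (show ¬ x.inv.1 < n from hx)]

lemma polygonIso_list_rotate (w : List Letter) {m : ℕ} (hm : m ≤ w.length) :
    PolygonIso w (w.rotate m) := by
  rw [List.rotate_eq_drop_append_take hm]
  conv => arg 1; rw [← List.take_append_drop m w]
  exact polygonIso_rotate _ _

/-- The words of the two polygons for `σ` and `μ` define homeomorphic surfaces. -/
def SurfaceEquiv (σ μ : SignedPerm n) : Prop :=
  PairEquiv (sourceWord n) (targetWord σ) (sourceWord n) (targetWord μ)

/-- Renaming i to i + t turns the words of `μ` into rotations of those of `σ`: t only renumbers the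
edges of `P`, and s those of `P'`. -/
lemma surfaceEquiv_circular {σ μ : SignedPerm n} {s t : Fin n}
    (h : ∀ (i : Fin n) (ε : ℤˣ),
      μ.toPerm (i, ε) = (s + (σ.toPerm (i + t, ε)).1, (σ.toPerm (i + t, ε)).2)) :
    SurfaceEquiv μ σ := by
  have : NeZero n := ⟨by have := s.2; omega⟩
  let π : SignedIndex n → SignedIndex n := fun p => (p.1 + t, p.2)
  have s1 := pairEquiv_relabel_signedIndex (π := π)
    (f := fun i => (i, 1)) (g := fun j => μ.toPerm.symm (j, 1))
    (by
      intro p q hpq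
      simp only [π, Prod.mk.injEq, add_left_inj] at hpq
      exact Prod.ext hpq.1 hpq.2) (fun p => rfl)
  have e1 : (List.ofFn fun i : Fin n => (π (i, 1)).toLetter) = (sourceWord n).rotate t := by
    refine List.ext_getElem (by simp [sourceWord]) fun i h1 h2 => ?_
    simp [sourceWord, List.getElem_rotate, π, SignedIndex.toLetter, Fin.val_add]
  -- Rotation by n - s is the shift by -s modulo n, as σ⁻¹ is evaluated at j - s; for s = 0 it is a
  -- full turn.
  have e2 : (List.ofFn fun j : Fin n => (π (μ.toPerm.symm (j, 1))).toLetter) =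
      (targetWord σ).rotate (n - s) := by
    refine List.ext_getElem (by simp [targetWord]) fun j h1 h2 => ?_
    rw [List.length_ofFn] at h1
    simp only [targetWord, List.getElem_ofFn, List.getElem_rotate, List.length_ofFn]
    congr 1
    rw [Equiv.eq_symm_apply]
    set p := μ.toPerm.symm (⟨j, h1⟩, 1) with hp
    have hμ : μ.toPerm p = (⟨j, h1⟩, 1) := by rw [hp, Equiv.apply_symm_apply]
    have hμ' := h p.1 p.2
    rw [Prod.mk.eta, hμ, Prod.mk.injEq] at hμ'
    refine Prod.ext ?_ hμ'.2.symm
    have h3 : (σ.toPerm (π p)).1 = ⟨j, h1⟩ - s := by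
      rw [eq_sub_iff_add_eq, add_comm]; exact hμ'.1.symm
    rw [h3]
    ext1
    rw [Fin.val_sub, add_comm]
  rw [e1, e2] at s1
  exact s1.trans (PolygonIso.pairEquiv
    (polygonIso_list_rotate _ (by rw [length_sourceWord]; exact t.2.le))
    (polygonIso_list_rotate _ (by rw [length_targetWord]; omega))).symm

end Spindle

namespace Spindle

open Set Topology

variable {n : ℕ}

/-! ### Reflections of an initial block. -/

lemma IsInitialBlock.apply_lt {σ : SignedPerm n} {k : Fin (n + 1)} (hk : IsInitialBlock σ k)
    {p : SignedIndex n} (hp : p.1.val < k.val) : (σ.toPerm p).1.val < k.val := by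
  have h := σ.apply_units_mul p.2 (p.1, 1)
  simp only [mul_one] at h
  rw [h]
  exact hk p.1 hp

/-- By finiteness, a permutation that maps the block into itself maps it onto itself. -/
lemma IsInitialBlock.symm_apply_lt {σ : SignedPerm n} {k : Fin (n + 1)} (hk : IsInitialBlock σ k)
    {p : SignedIndex n} (hp : p.1.val < k.val) : (σ.toPerm.symm p).1.val < k.val :=
  Equiv.Perm.perm_symm_on_of_perm_on_finite (f := σ.toPerm) (p := fun q => q.1.val < k.val)
    (fun _ hq => hk.apply_lt hq) hp

lemma IsInitialBlock.le_symm_apply {σ : SignedPerm n} {k : Fin (n + 1)} (hk : IsInitialBlock σ k)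
    {p : SignedIndex n} (hp : k.val ≤ p.1.val) : k.val ≤ (σ.toPerm.symm p).1.val := by
  by_contra! h
  have := hk.apply_lt h
  rw [Equiv.apply_symm_apply] at this
  omega

lemma mem_take_ofFn {f : Fin n → Letter} {k : ℕ} {x : Letter} (hx : x ∈ (List.ofFn f).take k) :
    ∃ i : Fin n, i.val < k ∧ f i = x := by
  obtain ⟨i, hi, rfl⟩ := List.mem_take_iff_getElem.1 hx
  simp only [List.length_ofFn, lt_inf_iff] at hi
  exact ⟨⟨i, hi.2⟩, hi.1, by simp⟩

lemma mem_drop_ofFn {f : Fin n → Letter} {k : ℕ} {x : Letter} (hx : x ∈ (List.ofFn f).drop k) :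
    ∃ i : Fin n, k ≤ i.val ∧ f i = x := by
  obtain ⟨i, hi, rfl⟩ := List.mem_drop_iff_getElem.1 hx
  simp only [List.length_ofFn] at hi
  exact ⟨⟨k + i, by omega⟩, by simp, by simp⟩

lemma letterCount_eq_one {a : ℕ} {w : List Letter} (hw : (w.map Prod.fst).Nodup)
    (ha : a ∈ w.map Prod.fst) : letterCount a w = 1 :=
  List.count_eq_one_of_mem hw ha

lemma nodup_sourceWord : ((sourceWord n).map Prod.fst).Nodup := by
  rw [sourceWord, List.map_ofFn, List.nodup_ofFn]
  exact Fin.val_injective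

lemma nodup_targetWord (σ : SignedPerm n) : ((targetWord σ).map Prod.fst).Nodup := by
  rw [targetWord, List.map_ofFn, List.nodup_ofFn]
  intro j j' h
  have h1 : (σ.toPerm.symm (j, 1)).1 = (σ.toPerm.symm (j', 1)).1 := Fin.ext h
  have h2 := σ.apply_units_mul ((σ.toPerm.symm (j, 1)).2 * (σ.toPerm.symm (j', 1)).2)
    (σ.toPerm.symm (j', 1))
  rw [mul_assoc, Int.units_mul_self, ← h1, mul_one, Prod.mk.eta, Equiv.apply_symm_apply,
    Equiv.apply_symm_apply] at h2
  exact congrArg Prod.fst h2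

/-- The effect of reflections of an initial block of `σ` on the boundary words. -/
lemma IsInitialBlock.pairEquiv {σ : SignedPerm n} {k : Fin (n + 1)} (hk : IsInitialBlock σ k) :
    PairEquiv (sourceWord n) (targetWord σ)
        (wordInv ((sourceWord n).take k) ++ (sourceWord n).drop k)
        (wordInv ((targetWord σ).take k) ++ (targetWord σ).drop k) ∧
      PairEquiv (sourceWord n) (targetWord σ)
        ((targetWord σ).take k ++ (sourceWord n).drop k)
        ((sourceWord n).take k ++ (targetWord σ).drop k) := by
  rcases Nat.eq_zero_or_pos k.val with h0 | h0
  · rw [h0]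
    simp only [List.take_zero, List.drop_zero, wordInv_nil, List.nil_append]
    exact ⟨MarkedHomeo.refl _ _, MarkedHomeo.refl _ _⟩
  -- For k < n, the first edge of `P` after the block, with letter k, serves as the edge b of
  -- `pairEquiv_block`. For k = n there is no edge outside the block to glue along, but then both
  -- polygons are simply mirrored or exchanged.
  rcases Nat.lt_or_ge k.val n with hn | hn
  · have hd : (sourceWord n).drop k = (k.val, 1) :: (sourceWord n).drop (k + 1) := by
      rw [List.drop_eq_getElem_cons (by rw [length_sourceWord]; exact hn)]
      simp [sourceWord, SignedIndex.toLetter]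
    have hA : ∀ x ∈ (sourceWord n).take k, x.1 < k.val := by
      intro x hx
      obtain ⟨i, hi, rfl⟩ := mem_take_ofFn hx
      exact hi
    have hC : ∀ x ∈ (targetWord σ).take k, x.1 < k.val := by
      intro x hx
      obtain ⟨i, hi, rfl⟩ := mem_take_ofFn hx
      exact hk.symm_apply_lt (p := (i, 1)) hi
    have hB : ∀ x ∈ (sourceWord n).drop (k + 1), k.val ≤ x.1 := by
      intro x hx
      obtain ⟨i, hi, rfl⟩ := mem_drop_ofFn hx
      exact (Nat.le_succ _).trans hi
    have hD : ∀ x ∈ (targetWord σ).drop k, k.val ≤ x.1 := by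
      intro x hx
      obtain ⟨i, hi, rfl⟩ := mem_drop_ofFn hx
      exact hk.le_symm_apply (p := (i, 1)) hi
    have memS : ∀ a, a < n → a ∈ (sourceWord n).map Prod.fst := by
      intro a ha
      rw [sourceWord, List.map_ofFn, List.mem_ofFn]
      exact ⟨⟨a, ha⟩, rfl⟩
    have memT : ∀ a, a < n → a ∈ (targetWord σ).map Prod.fst := by
      intro a ha
      rw [targetWord, List.map_ofFn, List.mem_ofFn]
      refine ⟨(σ.toPerm (⟨a, ha⟩, 1)).1, ?_⟩
      have h := σ.apply_units_mul (σ.toPerm (⟨a, ha⟩, 1)).2 (⟨a, ha⟩, 1)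
      rw [Int.units_mul_self] at h
      simp only [Function.comp_apply, ← h, Equiv.symm_apply_apply]
      rfl
    have cS : ∀ a, a < n → letterCount a ((sourceWord n).take k) +
        letterCount a ((sourceWord n).drop k) = 1 := by
      intro a ha
      rw [← letterCount_append, List.take_append_drop]
      exact letterCount_eq_one nodup_sourceWord (memS a ha)
    have cT : ∀ a, a < n → letterCount a ((targetWord σ).take k) +
        letterCount a ((targetWord σ).drop k) = 1 := by
      intro a ha
      rw [← letterCount_append, List.take_append_drop]
      exact letterCount_eq_one (nodup_targetWord σ) (memT a ha)
    have hS0 : ∀ a, k.val ≤ a → letterCount a ((sourceWord n).take k) = 0 := fun a ha =>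
      letterCount_eq_zero.2 fun x hx h => by have := hA x hx; omega
    have hT0 : ∀ a, k.val ≤ a → letterCount a ((targetWord σ).take k) = 0 := fun a ha =>
      letterCount_eq_zero.2 fun x hx h => by have := hC x hx; omega
    have hS1 : ∀ a, a < k.val → letterCount a ((sourceWord n).drop k) = 0 := fun a ha =>
      letterCount_eq_zero.2 fun x hx h => by
        obtain ⟨i, hi, rfl⟩ := mem_drop_ofFn hx
        simp only [SignedIndex.toLetter] at h
        omega
    have hT1 : ∀ a, a < k.val → letterCount a ((targetWord σ).drop k) = 0 := fun a ha =>
      letterCount_eq_zero.2 fun x hx h => by have := hD x hx; omega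
    have hAne : (sourceWord n).take k ≠ [] := by
      rw [← List.length_pos_iff, List.length_take, length_sourceWord]; omega
    have hCne : (targetWord σ).take k ≠ [] := by
      rw [← List.length_pos_iff, List.length_take, length_targetWord]; omega
    have key := pairEquiv_block (b := (k.val, 1)) hA hC le_rfl hB hD (fun a => by
        rcases Nat.lt_or_ge a k.val with ha | ha
        · have := cS a (by omega)
          have := cT a (by omega)
          have := hS1 a ha
          have := hT1 a ha
          omega
        · left; rw [hS0 a ha, hT0 a ha]) hAne hCne (by
        have h1 := cS k hn
        rw [hS0 k le_rfl, hd, letterCount_cons, letterHit_self] at h1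
        simp only
        omega) (by
        have h1 := cT k hn
        rwa [hT0 k le_rfl, zero_add] at h1)
    rw [← hd, List.take_append_drop, List.take_append_drop] at key
    exact key
  · have h1 : (sourceWord n).take k = sourceWord n :=
      List.take_of_length_le (by rw [length_sourceWord]; exact hn)
    have h2 : (targetWord σ).take k = targetWord σ :=
      List.take_of_length_le (by rw [length_targetWord]; exact hn)
    have h3 : (sourceWord n).drop k = [] :=
      List.drop_of_length_le (by rw [length_sourceWord]; exact hn)
    have h4 : (targetWord σ).drop k = [] :=
      List.drop_of_length_le (by rw [length_targetWord]; exact hn)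
    rw [h1, h2, h3, h4]
    simp only [List.append_nil]
    exact ⟨(polygonIso_wordInv _).pairEquiv (polygonIso_wordInv _), pairEquiv_swap _ _⟩

lemma revBlock_of_lt {k : Fin (n + 1)} {i : Fin n} (h : i.val < k.val) :
    (revBlock k i).val = k.val - 1 - i.val := by
  rw [revBlock, dif_pos h]

lemma revBlock_of_le {k : Fin (n + 1)} {i : Fin n} (h : k.val ≤ i.val) : revBlock k i = i := by
  rw [revBlock, dif_neg (by omega)]

lemma revBlock_lt {k : Fin (n + 1)} {i : Fin n} (h : i.val < k.val) :
    (revBlock k i).val < k.val := by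
  rw [revBlock_of_lt h]; omega

lemma revBlock_revBlock (k : Fin (n + 1)) (i : Fin n) : revBlock k (revBlock k i) = i := by
  rcases Nat.lt_or_ge i.val k.val with h | h
  · ext1
    rw [revBlock_of_lt (revBlock_lt h), revBlock_of_lt h]; omega
  · rw [revBlock_of_le h, revBlock_of_le h]

lemma ofFn_eq_take_append_drop {f g h : Fin n → Letter} {k : Fin (n + 1)}
    (hlt : ∀ i : Fin n, i.val < k.val → f i = g i) (hge : ∀ i : Fin n, k.val ≤ i.val → f i = h i) :
    List.ofFn f = (List.ofFn g).take k ++ (List.ofFn h).drop k := by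
  have hkn : k.val ≤ n := Nat.lt_succ_iff.1 k.2
  refine List.ext_getElem (by simp; omega) fun i h1 h2 => ?_
  rw [List.length_ofFn] at h1
  rw [List.getElem_ofFn]
  rcases Nat.lt_or_ge i k.val with hi | hi
  · rw [List.getElem_append_left (by simp; omega), List.getElem_take, List.getElem_ofFn]
    exact hlt ⟨i, h1⟩ hi
  · rw [List.getElem_append_right (by simp; omega), List.getElem_drop, List.getElem_ofFn,
      hge ⟨i, h1⟩ hi]
    congr 2
    simp only [List.length_take, List.length_ofFn]
    omega

lemma ofFn_eq_wordInv_take_append_drop {f g : Fin n → Letter} {k : Fin (n + 1)}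
    (hlt : ∀ i : Fin n, i.val < k.val → f i = (g (revBlock k i)).inv)
    (hge : ∀ i : Fin n, k.val ≤ i.val → f i = g i) :
    List.ofFn f = wordInv ((List.ofFn g).take k) ++ (List.ofFn g).drop k := by
  have hkn : k.val ≤ n := Nat.lt_succ_iff.1 k.2
  rw [ofFn_eq_take_append_drop (g := f) (h := g) (fun _ _ => rfl) hge]
  congr 1
  refine List.ext_getElem (by simp) fun i h1 h2 => ?_
  simp only [List.length_take, List.length_ofFn, lt_inf_iff] at h1
  simp only [wordInv, List.getElem_reverse, List.getElem_map, List.getElem_take, List.getElem_ofFn]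
  rw [hlt ⟨i, h1.2⟩ h1.1]
  congr 3
  rw [← Fin.val_inj, revBlock_of_lt h1.1]
  simp only [List.length_map, List.length_take, List.length_ofFn]
  omega

/-- Renaming the letters of the block by reversal together with a change of sign turns the words of
`μ` into those of `σ` with the first k letters inverted as a word. The sign is needed because
inverting a word also inverts each letter. -/
lemma surfaceEquiv_vertical {σ μ : SignedPerm n} {k : Fin (n + 1)} (hk : IsInitialBlock σ k)
    (h : ∀ (i : Fin n) (ε : ℤˣ),
      μ.toPerm (i, ε) =
        if i.val < k.val then
          (revBlock k (σ.toPerm (revBlock k i, ε)).1, (σ.toPerm (revBlock k i, ε)).2)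
        else σ.toPerm (i, ε)) : SurfaceEquiv μ σ := by
  let π : SignedIndex n → SignedIndex n := fun p =>
    (revBlock k p.1, if p.1.val < k.val then -p.2 else p.2)
  have hπ : ∀ p, π (π p) = p := by
    rintro ⟨i, ε⟩
    rcases Nat.lt_or_ge i.val k.val with hi | hi
    · simp [π, revBlock_revBlock, hi, revBlock_lt hi]
    · simp [π, revBlock_of_le hi, hi.not_gt]
  have s1 := pairEquiv_relabel_signedIndex (π := π)
    (f := fun i => (i, 1)) (g := fun j => μ.toPerm.symm (j, 1))
    (Function.LeftInverse.injective hπ) (fun p => by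
      by_cases hp : p.1.val < k.val <;> simp [π, SignedIndex.opp, hp])
  have e1 : (List.ofFn fun i : Fin n => (π (i, 1)).toLetter) =
      wordInv ((sourceWord n).take k) ++ (sourceWord n).drop k := by
    refine ofFn_eq_wordInv_take_append_drop (fun i hi => ?_) fun i hi => ?_
    · simp [π, hi, SignedIndex.toLetter, Letter.inv]
    · simp [π, hi.not_gt, revBlock_of_le hi]
  have e2 : (List.ofFn fun j : Fin n => (π (μ.toPerm.symm (j, 1))).toLetter) =
      wordInv ((targetWord σ).take k) ++ (targetWord σ).drop k := by
    refine ofFn_eq_wordInv_take_append_drop (fun j hj => ?_) fun j hj => ?_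
    · set q := σ.toPerm.symm (revBlock k j, 1) with hq
      have hqk : q.1.val < k.val := hk.symm_apply_lt (revBlock_lt hj)
      have hμ : μ.toPerm (revBlock k q.1, q.2) = (j, 1) := by
        rw [h, if_pos (revBlock_lt hqk), revBlock_revBlock, Prod.mk.eta, hq,
          Equiv.apply_symm_apply, revBlock_revBlock]
      rw [← hμ, Equiv.symm_apply_apply, ← SignedIndex.toLetter_opp]
      simp [π, revBlock_revBlock, revBlock_lt hqk, SignedIndex.opp]
    · set q := σ.toPerm.symm (j, 1) with hq
      have hqk : k.val ≤ q.1.val := hk.le_symm_apply hj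
      have hμ : μ.toPerm q = (j, 1) := by
        have := h q.1 q.2
        rw [Prod.mk.eta, if_neg hqk.not_gt] at this
        rw [this, hq, Equiv.apply_symm_apply]
      rw [← hμ, Equiv.symm_apply_apply]
      simp [π, revBlock_of_le hqk, hqk.not_gt]
  rw [e1, e2] at s1
  exact s1.trans hk.pairEquiv.1.symm

/-- Renaming the letters of the block by σ⁻¹ turns the words of `μ` into those of `σ` with their
first k letters exchanged between the two polygons: passing to the inverse lets `P` and `P'` change
roles on the block. -/
lemma surfaceEquiv_horizontal {σ μ : SignedPerm n} {k : Fin (n + 1)} (hk : IsInitialBlock σ k)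
    (h : ∀ (i : Fin n) (ε : ℤˣ),
      μ.toPerm (i, ε) =
        if i.val < k.val then σ.toPerm.symm (i, ε) else σ.toPerm (i, ε)) :
    SurfaceEquiv μ σ := by
  let π : SignedIndex n → SignedIndex n := fun p =>
    if p.1.val < k.val then σ.toPerm.symm p else p
  have s1 := pairEquiv_relabel_signedIndex (π := π)
    (f := fun i => (i, 1)) (g := fun j => μ.toPerm.symm (j, 1))
    (by
      intro p q hpq
      simp only [π] at hpq
      split_ifs at hpq with hp hq hq
      · exact σ.toPerm.symm.injective hpq
      · exact absurd (hpq ▸ hk.symm_apply_lt hp) hq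
      · exact absurd (hpq ▸ hk.symm_apply_lt hq) hp
      · exact hpq)
    (fun p => by
      by_cases hp : p.1.val < k.val
      · simp only [π, if_pos hp, if_pos (show p.opp.1.val < k.val from hp), σ.symm_opp]
      · simp only [π, if_neg hp, if_neg (show ¬ p.opp.1.val < k.val from hp)])
  have e1 : (List.ofFn fun i : Fin n => (π (i, 1)).toLetter) =
      (targetWord σ).take k ++ (sourceWord n).drop k := by
    refine ofFn_eq_take_append_drop (fun i hi => ?_) fun i hi => ?_
    · simp [π, hi]
    · simp [π, hi.not_gt]
  have e2 : (List.ofFn fun j : Fin n => (π (μ.toPerm.symm (j, 1))).toLetter) =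
      (sourceWord n).take k ++ (targetWord σ).drop k := by
    refine ofFn_eq_take_append_drop (fun j hj => ?_) fun j hj => ?_
    · set q := σ.toPerm (j, 1) with hq
      have hqk : q.1.val < k.val := hk.apply_lt hj
      have hμ : μ.toPerm q = (j, 1) := by
        have := h q.1 q.2
        rw [Prod.mk.eta, if_pos hqk] at this
        rw [this, hq, Equiv.symm_apply_apply]
      rw [← hμ, Equiv.symm_apply_apply, hμ]
      simp only [π, if_pos hqk]
      rw [hq, Equiv.symm_apply_apply]
    · set q := σ.toPerm.symm (j, 1) with hq
      have hqk : k.val ≤ q.1.val := hk.le_symm_apply hj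
      have hμ : μ.toPerm q = (j, 1) := by
        have := h q.1 q.2
        rw [Prod.mk.eta, if_neg hqk.not_gt] at this
        rw [this, hq, Equiv.apply_symm_apply]
      rw [← hμ, Equiv.symm_apply_apply]
      simp [π, hqk.not_gt]
  rw [e1, e2] at s1
  exact s1.trans hk.pairEquiv.2.symm

lemma SpindleMove.surfaceEquiv {σ μ : SignedPerm n} (h : SpindleMove σ μ) : SurfaceEquiv σ μ := by
  cases h with
  | circular s t h => exact (surfaceEquiv_circular h).symm
  | vertical k hk h => exact (surfaceEquiv_vertical hk h).symm
  | horizontal k hk h => exact (surfaceEquiv_horizontal hk h).symm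

lemma SpindleEquiv.surfaceEquiv {σ τ : SignedPerm n} (h : SpindleEquiv σ τ) :
    SurfaceEquiv σ τ := by
  induction h with
  | rel _ _ h => exact h.surfaceEquiv
  | refl => exact MarkedHomeo.refl _ _
  | symm _ _ _ ih => exact ih.symm
  | trans _ _ _ _ _ ih ih' => exact ih.trans ih'

end Spindle

theorem mainTheorem8 (n : ℕ) (hn : 1 ≤ n) (σ τ : Spindle.SignedPerm n)
    (h : Spindle.SpindleEquiv σ τ) :
    Spindle.vertexCount σ = Spindle.vertexCount τ ∧
      Nonempty (Spindle.Surface σ ≃ₜ Spindle.Surface τ) := by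
  obtain ⟨e, he⟩ := (Spindle.surface_markedHomeo σ).trans
    (h.surfaceEquiv.trans (Spindle.surface_markedHomeo τ).symm)
  refine ⟨?_, ⟨e⟩⟩
  rw [Spindle.vertexCount, Spindle.vertexCount, Spindle.zeroCells_eq, Spindle.zeroCells_eq]
  refine (Set.ncard_image_of_injective _ e.injective).symm.trans ?_
  exact congrArg Set.ncard he
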